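/- All manifolds are smooth, real, finite-dimensional and without boundary; the base $M$ is Hausdorff and second countable. Let $\mu:P\to M$ be a smooth principal bundle with structure Lie group $G$ and right action $\kappa_g(p)=\kappa_p(g)=pg$; let $T^vP=\operatorname{Ker}T\mu$ be the vertical subbundle. For a manifold $Q$ let $Aut_0TQ$ be the group of smooth automorphisms $A=(A(q):T_qQ\to T_qQ)_{q\in Q}$ of the tangent bundle covering $\mathrm{id}_Q$. The tangent group $TG\cong G\ltimes T_eG$ acts on $TP$ by $\Phi_{(g,X)}(v)=T\kappa_g(p)\big(v+T\kappa_p(e)X\big)$, $v\in T_pP$, $g\in G$, $X\in T_eG$, where $e$ is the unit of $G$. Let - $Aut_{TG}TP\subset Aut_0TP$ be the subgroup of those $A$ with $A(pg)\circ\Phi_{(g,X)}=\Phi_{(g,X)}\circ A(p)$ for all $g,X,p$; - $Aut_NTP\subset Aut_{TG}TP$ be the subgroup of those $A$ with $A(p)=\mathrm{id}_p+B(p)$, $B(p):T_pP\to T^v_pP$, for all $p$; - $End_NTP$ be the vector space of smooth families $B(p)\in End(T_pP)$ with $B(pg)\circ T\kappa_g(p)=T\kappa_g(p)\circ B(p)$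 and $\operatorname{Im}B(p)\subset T^v_pP\subset\operatorname{Ker}B(p)$ for all $p,g$. A connection $\alpha$ is a smooth $T_eG$-valued one-form on $P$ with $\alpha_p\circ T\kappa_p(e)=\mathrm{id}$ and $\alpha_{pg}\circ T\kappa_g(p)=Ad_{g^{-1}}\circ\alpha_p$. Let $\Gamma_\alpha(p):T_{\mu(p)}M\to\operatorname{Ker}\alpha_p$ be the inverse of $T\mu(p)|_{\operatorname{Ker}\alpha_p}$ and $\Pi^v_\alpha(p)=T\kappa_p(e)\circ\alpha_p$ the projection of $T_pP$ onto $T^v_pP$ along $\operatorname{Ker}\alpha_p$. **Proposition.** The map $B\mapsto\mathrm{id}+B$ is an isomorphism of the additive group $End_NTP$ onto $Aut_NTP$ (so $Aut_NTP$ is abelian). Moreover: (i) There is a unique map $\lambda:Aut_{TG}TP\to Aut_0TM$ with $\lambda(A)(\mu(p))\,T\mu(p)v=T\mu(p)A(p)v$ for all $A$, $p\in P$, $v\in T_pP$; it is a group homomorphism, and with the inclusion $\iota$ the sequence $$\{\mathrm{id}\}\to Aut_NTP\xrightarrow{\ \iota\ }Aut_{TG}TP\xrightarrow{\ \lambda\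 }Aut_0TM\to\{\mathrm{id}\}$$ is exact. (ii) For every connection $\alpha$ the formula $$\sigma_\alpha(\tilde A)(p)=\Pi^v_\alpha(p)+\Gamma_\alpha(p)\circ\tilde A(\mu(p))\circ T\mu(p)$$ defines an injective group homomorphism $\sigma_\alpha:Aut_0TM\to Aut_{TG}TP$, and $\beta_\alpha(A)=A\,\sigma_\alpha(\lambda(A))^{-1}$ defines a surjection $\beta_\alpha:Aut_{TG}TP\to Aut_NTP$, such that $\beta_\alpha^{-1}(\mathrm{id})=\operatorname{Im}\sigma_\alpha$, $\lambda\circ\sigma_\alpha=\mathrm{id}$, $\beta_\alpha\circ\iota=\mathrm{id}$, and $$\beta_\alpha(A_1A_2)=\beta_\alpha(A_1)\,\sigma_\alpha(\lambda(A_1))\,\beta_\alpha(A_2)\,\sigma_\alpha(\lambda(A_1))^{-1}.$$ (iii) For every connection $\alpha$ the decomposition $A=(\mathrm{id}+B)\,\sigma_\alpha(\tilde A)$ defines an isomorphism of $Aut_{TG}TP$ with a semidirect product group $Aut_0TM\ltimes_\alpha End_NTP$, whose product is $$(\tilde A_1,B_1)\cdot(\tilde A_2,B_2)=\big(\tilde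 A_1\tilde A_2,\;B_1+B_2\circ\Gamma_\alpha\circ\tilde A_1^{-1}\circ T\mu\big),$$ that is, the second component at $p$ is $B_1(p)+B_2(p)\circ\Gamma_\alpha(p)\circ\tilde A_1(\mu(p))^{-1}\circ T\mu(p)$. -/

import Mathlib

open Set Bundle
open scoped Manifold ContDiff

section Aut
variable {E H : Type*} [NormedAddCommGroup E] [NormedSpace ℝ E] [TopologicalSpace H]
  {I : ModelWithCorners ℝ E H} {X : Type*} [TopologicalSpace X] [ChartedSpace H X]

/-- A family of endomorphisms `B x : T_x X → T_x X` depends smoothly on `x`: the fibre-preserving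
map `TX → TX` that it defines is smooth. -/
def IsSmoothTangentEndo [IsManifold I ∞ X] (B : ∀ x : X, TangentSpace I x →L[ℝ] TangentSpace I x) : Prop :=
  ContMDiff I.tangent I.tangent ∞
    (fun v : TangentBundle I X => (⟨v.proj, B v.proj v.snd⟩ : TangentBundle I X))

variable [IsManifold I ∞ X]

theorem IsSmoothTangentEndo.iff_coord (B : ∀ x : X, TangentSpace I x →L[ℝ] TangentSpace I x) :
    IsSmoothTangentEndo B ↔ ∀ v : TangentBundle I X,
      ContMDiffAt I.tangent 𝓘(ℝ, E) ∞ (fun w : TangentBundle I X =>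
        (trivializationAt E (TangentSpace I) v.proj ⟨w.proj, B w.proj w.snd⟩).2) v := by
  refine forall_congr' fun v => ?_
  rw [contMDiffAt_totalSpace]
  exact and_iff_right (contMDiffAt_proj (TangentSpace I))

theorem tangent_coord_linear (x : X) {y : X} (hy : y ∈ (trivializationAt E (TangentSpace I) x).baseSet)
   (v : TangentSpace I y) :  (trivializationAt E (TangentSpace I) x ⟨y, v⟩).2
     = (trivializationAt E (TangentSpace I) x).continuousLinearEquivAt ℝ y hy v := rfl

theorem tangent_eventually_mem_baseSet (v : TangentBundle I X) :
    ∀ᶠ w : TangentBundle I X in nhds v,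
      w.proj ∈ (trivializationAt E (TangentSpace I) v.proj).baseSet :=
  (FiberBundle.continuous_proj E (TangentSpace I)).continuousAt.eventually
    ((trivializationAt E (TangentSpace I) v.proj).open_baseSet.mem_nhds
      (mem_baseSet_trivializationAt E (TangentSpace I) v.proj))

theorem IsSmoothTangentEndo.add {B C : ∀ x : X, TangentSpace I x →L[ℝ] TangentSpace I x}
    (hB : IsSmoothTangentEndo B) (hC : IsSmoothTangentEndo C) : IsSmoothTangentEndo (fun x => B x + C x) := by
  rw [IsSmoothTangentEndo.iff_coord] at *
  intro v
  refine ((hB v).add (hC v)).congr_of_eventuallyEq ?_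
  have hn : ∀ᶠ w : TangentBundle I X in nhds v, w.proj ∈ (trivializationAt E (TangentSpace I) v.proj).baseSet :=
    (FiberBundle.continuous_proj E (TangentSpace I)).continuousAt.eventually
      ((trivializationAt E (TangentSpace I) v.proj).open_baseSet.mem_nhds (mem_baseSet_trivializationAt E (TangentSpace I) v.proj))
  filter_upwards [hn] with w hw
  simp only [Pi.add_apply, tangent_coord_linear _ hw, ← map_add]
  rfl

theorem IsSmoothTangentEndo.inv [FiniteDimensional ℝ E] {A : ∀ x : X, TangentSpace I x ≃L[ℝ] TangentSpace I x}
    (hA : IsSmoothTangentEndo (fun x => (A x : TangentSpace I x →L[ℝ] TangentSpace I x))) :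
    IsSmoothTangentEndo (fun x => ((A x).symm : TangentSpace I x →L[ℝ] TangentSpace I x)) := by
  rw [IsSmoothTangentEndo.iff_coord]
  intro v
  set x := v.proj with hx
  set e := trivializationAt E (TangentSpace I) x with he
  have hxe : x ∈ e.baseSet := mem_baseSet_trivializationAt E (TangentSpace I) x
  -- the matrix of `A` in the trivialization at `x`
  let a : X → E →L[ℝ] E := fun y => (e.continuousLinearMapAt ℝ y).comp
    ((A y : TangentSpace I y →L[ℝ] TangentSpace I y).comp (e.symmL ℝ y))
  have hvec : ∀ u : E, ContMDiffAt I 𝓘(ℝ, E) ∞ (fun y => a y u) x := by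
    intro u
    have h1 : ContMDiffAt I I.tangent ∞ (fun y : X => (⟨y, e.symm y u⟩ : TangentBundle I X)) x := by
      rw [contMDiffAt_section]
      refine (contMDiffAt_const (c := u)).congr_of_eventuallyEq ?_
      filter_upwards [e.open_baseSet.mem_nhds hxe] with y hy
      have := e.apply_mk_symm hy u
      rw [← he, this]
    have h2 := ((hA _).comp x h1)
    rw [contMDiffAt_totalSpace] at h2
    refine h2.2.congr_of_eventuallyEq ?_
    filter_upwards [e.open_baseSet.mem_nhds hxe] with y hy
    simp only [a, ContinuousLinearMap.comp_apply, Bundle.Trivialization.continuousLinearMapAt_apply,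
      Bundle.Trivialization.coe_linearMapAt_of_mem _ hy, Bundle.Trivialization.symmL_apply e hy]
    rfl
  have hclm : ContMDiffAt I 𝓘(ℝ, E →L[ℝ] E) ∞ a x := by
    let b := Module.finBasis ℝ E
    have h : a = fun y => ∑ i, ContinuousLinearMap.smulRightL ℝ E E
        (LinearMap.toContinuousLinearMap (b.coord i)) (a y (b i)) := by
      funext y
      ext u
      conv_lhs => rw [← b.sum_repr u]
      simp only [map_sum, map_smul]
      simp
    rw [h]
    refine ContMDiffAt.sum fun i _ => ?_
    exact (ContinuousLinearMap.smulRightL ℝ E E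
        (LinearMap.toContinuousLinearMap (b.coord i))).contMDiff.contMDiffAt.comp x (hvec (b i))
  have hai : ∀ y (hy : y ∈ e.baseSet), a y =
      (((e.continuousLinearEquivAt ℝ y hy).symm.trans ((A y).trans
        (e.continuousLinearEquivAt ℝ y hy)) : E ≃L[ℝ] E) : E →L[ℝ] E) := by
    intro y hy
    ext u
    simp only [a, ContinuousLinearMap.comp_apply, Bundle.Trivialization.continuousLinearMapAt_apply,
      Bundle.Trivialization.coe_linearMapAt_of_mem _ hy]
    rw [← Bundle.Trivialization.symm_continuousLinearEquivAt_eq e hy]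
    rfl
  have hinv : ContMDiffAt I 𝓘(ℝ, E →L[ℝ] E) ∞ (fun y => ContinuousLinearMap.inverse (a y)) x := by
    refine ContMDiffAt.comp (g := ContinuousLinearMap.inverse) x ?_ hclm
    rw [hai x hxe]
    exact (contDiffAt_map_inverse _).contMDiffAt
  have hinv' : ContMDiffAt I.tangent 𝓘(ℝ, E →L[ℝ] E) ∞
      (fun w : TangentBundle I X => ContinuousLinearMap.inverse (a w.proj)) v :=
    ContMDiffAt.comp (g := fun y => ContinuousLinearMap.inverse (a y)) v hinv
      (contMDiffAt_proj (TangentSpace I))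
  have hv := ((contMDiffAt_totalSpace (IB := I) (n := ∞) (f := fun w : TangentBundle I X => w) (x₀ := v)).1 contMDiffAt_id).2
  refine (hinv'.clm_apply hv).congr_of_eventuallyEq ?_
  have hn : ∀ᶠ w : TangentBundle I X in nhds v, w.proj ∈ e.baseSet :=
    (FiberBundle.continuous_proj E (TangentSpace I)).continuousAt.eventually
      (e.open_baseSet.mem_nhds hxe)
  filter_upwards [hn] with w hw
  rw [hai _ hw, ContinuousLinearMap.inverse_equiv, tangent_coord_linear _ hw]
  change _ = e.continuousLinearEquivAt ℝ w.proj hw ((A w.proj).symm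
    ((e.continuousLinearEquivAt ℝ w.proj hw).symm (e.continuousLinearEquivAt ℝ w.proj hw w.snd)))
  rw [ContinuousLinearEquiv.symm_apply_apply]
  rfl
theorem IsSmoothTangentEndo.zero : IsSmoothTangentEndo (fun x : X => (0 : TangentSpace I x →L[ℝ] TangentSpace I x)) := by
  rw [IsSmoothTangentEndo.iff_coord]
  intro v
  refine (contMDiffAt_const (c := (0 : E))).congr_of_eventuallyEq ?_
  filter_upwards [tangent_eventually_mem_baseSet v] with w hw
  rw [tangent_coord_linear _ hw]
  exact map_zero _

theorem IsSmoothTangentEndo.const_smul (c : ℝ) {B : ∀ x : X, TangentSpace I x →L[ℝ] TangentSpace I x}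
    (hB : IsSmoothTangentEndo B) : IsSmoothTangentEndo (fun x => c • B x) := by
  rw [IsSmoothTangentEndo.iff_coord] at *
  intro v
  refine ((contMDiffAt_const (I := I.tangent) (I' := 𝓘(ℝ, ℝ)) (x := v) (n := ∞) (c := c)).smul (hB v)).congr_of_eventuallyEq ?_
  filter_upwards [tangent_eventually_mem_baseSet v] with w hw
  simp only [Pi.smul_apply', tangent_coord_linear _ hw]
  exact map_smul _ c _

variable [FiniteDimensional ℝ E]

variable (I X) in
/-- The group `Aut₀ TX` of smooth automorphisms of the tangent bundle `TX` covering `id_X`: families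
of linear isomorphisms `A x : T_x X → T_x X` depending smoothly on `x`, with pointwise
composition `(A * B) x = A x ∘ B x`. -/
def TangentAut : Subgroup (∀ x : X, TangentSpace I x ≃L[ℝ] TangentSpace I x) where
  carrier := {A | IsSmoothTangentEndo (fun x => (A x : TangentSpace I x →L[ℝ] TangentSpace I x))}
  one_mem' := contMDiff_id
  mul_mem' {A _} hA hB := ContMDiff.comp (I' := I.tangent)
    (g := fun v : TangentBundle I X => (⟨v.proj, A v.proj v.snd⟩ : TangentBundle I X)) hA hB
  inv_mem' hA := hA.inv

end Aut

section PB
variable {EM HM EG HG EP HP : Type*}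
  [NormedAddCommGroup EM] [NormedSpace ℝ EM] [TopologicalSpace HM]
  [NormedAddCommGroup EG] [NormedSpace ℝ EG] [TopologicalSpace HG]
  [NormedAddCommGroup EP] [NormedSpace ℝ EP] [TopologicalSpace HP]

/-- A smooth principal `G`-bundle `proj : P → M` with right action `act p g = p g`, locally trivial
through `G`-equivariant diffeomorphisms `proj ⁻¹' U ≃ U × G` over the open sets `U` of a cover. -/
structure PrincipalBundle (IM : ModelWithCorners ℝ EM HM) (IG : ModelWithCorners ℝ EG HG)
    (IP : ModelWithCorners ℝ EP HP) (M G P : Type*)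
    [TopologicalSpace M] [ChartedSpace HM M] [TopologicalSpace G] [ChartedSpace HG G] [Group G]
    [TopologicalSpace P] [ChartedSpace HP P] where
  proj : P → M
  act : P → G → P
  contMDiff_proj : ContMDiff IP IM ∞ proj
  contMDiff_act : ContMDiff (IP.prod IG) IP ∞ (fun x : P × G => act x.1 x.2)
  act_one : ∀ p, act p 1 = p
  act_mul : ∀ p g h, act p (g * h) = act (act p g) h
  proj_act : ∀ p g, proj (act p g) = proj p
  exists_trivialization : ∀ m : M, ∃ (U : Set M) (e : OpenPartialHomeomorph P (M × G)),
    IsOpen U ∧ m ∈ U ∧ e.source = proj ⁻¹' U ∧ e.target = U ×ˢ (univ : Set G) ∧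
    ContMDiffOn IP (IM.prod IG) ∞ e e.source ∧
    ContMDiffOn (IM.prod IG) IP ∞ e.symm e.target ∧
    (∀ p ∈ e.source, (e p).1 = proj p) ∧
    (∀ p ∈ e.source, ∀ g, e (act p g) = ((e p).1, (e p).2 * g))

namespace PrincipalBundle
variable {IM : ModelWithCorners ℝ EM HM} {IG : ModelWithCorners ℝ EG HG}
  {IP : ModelWithCorners ℝ EP HP} {M G P : Type*}
  [TopologicalSpace M] [ChartedSpace HM M] [TopologicalSpace G] [ChartedSpace HG G] [Group G]
  [TopologicalSpace P] [ChartedSpace HP P]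
  (𝔓 : PrincipalBundle IM IG IP M G P)

/-- The differential `T_p μ : T_p P → T_{μ(p)} M` of the projection. -/
noncomputable def Tproj (p : P) : TangentSpace IP p →L[ℝ] TangentSpace IM (𝔓.proj p) :=
  mfderiv IP IM 𝔓.proj p

/-- The differential `T κ_g(p) : T_p P → T_{pg} P` of the right translation `κ_g`. -/
noncomputable def Tact (g : G) (p : P) : TangentSpace IP p →L[ℝ] TangentSpace IP (𝔓.act p g) :=
  mfderiv IP IP (fun q => 𝔓.act q g) p

/-- The differential `T κ_p(e) : T_e G → T_p P` of the orbit map `κ_p : g ↦ p g` at the unit. (It takes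
values in the tangent space at `p e = p`.) -/
noncomputable def fund (p : P) : TangentSpace IG (1 : G) →L[ℝ] TangentSpace IP p :=
  mfderiv IG IP (𝔓.act p) 1

/-- The vertical subspace `T^v_p P = Ker T_p μ`. -/
noncomputable def vert (p : P) : Submodule ℝ (TangentSpace IP p) := (𝔓.Tproj p).ker

theorem mdiff_proj (p : P) : MDifferentiableAt IP IM 𝔓.proj p :=
  (𝔓.contMDiff_proj p).mdifferentiableAt (by simp)

theorem mdiff_act_snd  [IsManifold IP ∞ P] [IsManifold IG ∞ G] (p : P) (g : G) : MDifferentiableAt IG IP (𝔓.act p) g :=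
  ((𝔓.contMDiff_act.comp (contMDiff_const.prodMk contMDiff_id)) g).mdifferentiableAt (by simp)

theorem Tproj_fund [IsManifold IP ∞ P] [IsManifold IG ∞ G] (p : P) (X : TangentSpace IG (1 : G)) : 𝔓.Tproj p (𝔓.fund p X) = 0 := by
  have hc : 𝔓.proj ∘ 𝔓.act p = fun _ => 𝔓.proj p := funext fun g => 𝔓.proj_act p g
  have h1 := mfderiv_comp (I'' := IM) (1 : G) (𝔓.mdiff_proj (𝔓.act p 1)) (𝔓.mdiff_act_snd p 1)
  rw [hc, mfderiv_const] at h1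
  have key : ∀ p' : P, p' = p → ∀ w : EP,
    (mfderiv IP IM 𝔓.proj p' : EP →L[ℝ] EM) w = (mfderiv IP IM 𝔓.proj p : EP →L[ℝ] EM) w := by
    rintro _ rfl _; rfl
  have h2 := DFunLike.congr_fun h1 X
  exact (key _ (𝔓.act_one p) _).symm.trans h2.symm

theorem exists_section [IsManifold IP ∞ P] [IsManifold IM ∞ M] [LieGroup IG ∞ G]  (p : P) : ∃ (s : M → P) (h : P → G), MDifferentiableAt IM IP s (𝔓.proj p) ∧
    MDifferentiableAt IP IG h p ∧ s (𝔓.proj p) = p ∧ h p = 1 ∧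
    (∀ᶠ m in nhds (𝔓.proj p), 𝔓.proj (s m) = m) ∧
    ∀ᶠ q in nhds p, 𝔓.act (s (𝔓.proj q)) (h q) = q := by
  obtain ⟨U, e, hU, hpU, hs, ht, he, hes, he1, hea⟩ := 𝔓.exists_trivialization (𝔓.proj p)
  have hp : p ∈ e.source := by rw [hs]; exact hpU
  have hms : ∀ m ∈ U, ∀ g : G, e.symm (m, g) ∈ e.source := fun m hm g =>
    e.map_target (by rw [ht]; exact ⟨hm, mem_univ _⟩)
  have hr : ∀ m ∈ U, ∀ g : G, e (e.symm (m, g)) = (m, g) := fun m hm g =>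
    e.right_inv (by rw [ht]; exact ⟨hm, mem_univ _⟩)
  have hmdt : ∀ x ∈ e.target, MDifferentiableAt (IM.prod IG) IP e.symm x := fun x hx =>
    ((hes x hx).contMDiffAt (e.open_target.mem_nhds hx)).mdifferentiableAt (by simp)
  refine ⟨fun m => e.symm (m, (e p).2), fun q => (e p).2⁻¹ * (e q).2, ?_, ?_, ?_, by simp, ?_, ?_⟩
  · exact MDifferentiableAt.comp (g := e.symm) (f := fun m => (m, (e p).2)) _
      (hmdt _ (by rw [ht]; exact ⟨hpU, mem_univ _⟩)) (mdifferentiableAt_id.prodMk mdifferentiableAt_const)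
  · have h1 : MDifferentiableAt IP (IM.prod IG) e p :=
      ((he p hp).contMDiffAt (e.open_source.mem_nhds hp)).mdifferentiableAt (by simp)
    have h2 : MDifferentiableAt IP IG (fun q => (e q).2) p := h1.snd
    exact MDifferentiableAt.comp (g := fun g => (e p).2⁻¹ * g) p
      ((contMDiff_mul_left (I := IG) (n := ∞) _).mdifferentiableAt (by simp)) h2
  · have : (𝔓.proj p, (e p).2) = e p := by rw [← he1 p hp]
    simp only [this]
    exact e.left_inv hp
  · filter_upwards [hU.mem_nhds hpU] with m hm
    rw [← he1 _ (hms m hm _), hr m hm]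
  · filter_upwards [e.open_source.mem_nhds hp] with q hq
    have hqU : 𝔓.proj q ∈ U := by rw [hs] at hq; exact hq
    have hq' := hms _ hqU (e p).2
    have hq'' : 𝔓.act (e.symm (𝔓.proj q, (e p).2)) ((e p).2⁻¹ * (e q).2) ∈ e.source := by
      rw [hs, mem_preimage, 𝔓.proj_act, ← mem_preimage, ← hs]; exact hq'
    refine e.injOn hq'' hq ?_
    rw [hea _ hq', hr _ hqU, ← he1 q hq]
    simp

theorem Tproj_surjective [IsManifold IP ∞ P] [IsManifold IM ∞ M] [LieGroup IG ∞ G] (p : P) :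
    Function.Surjective (𝔓.Tproj p) := by
  obtain ⟨s, h, hs, -, hsp, -, hps, -⟩ := 𝔓.exists_section p
  intro w
  have h1 := mfderiv_comp (I'' := IM) (𝔓.proj p) (𝔓.mdiff_proj (s (𝔓.proj p))) hs
  have hid : 𝔓.proj ∘ s =ᶠ[nhds (𝔓.proj p)] id := hps
  rw [hid.mfderiv_eq, mfderiv_id] at h1
  have key : ∀ p' : P, p' = p → ∀ w : EP,
    (mfderiv IP IM 𝔓.proj p' : EP →L[ℝ] EM) w = (mfderiv IP IM 𝔓.proj p : EP →L[ℝ] EM) w := by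
    rintro _ rfl _; rfl
  exact ⟨(mfderiv IM IP s (𝔓.proj p) w : EP), (key _ hsp _).symm.trans (DFunLike.congr_fun h1 w).symm⟩

theorem vert_le_range_fund [IsManifold IP ∞ P] [IsManifold IM ∞ M] [LieGroup IG ∞ G] (p : P)
    (v : TangentSpace IP p) (hv : 𝔓.Tproj p v = 0) : ∃ X, 𝔓.fund p X = v := by
  obtain ⟨s, h, hs, hh, hsp, hh1, -, hq⟩ := 𝔓.exists_section p
  let a : P × G → P := fun x => 𝔓.act x.1 x.2
  have ha : ∀ x, MDifferentiableAt (IP.prod IG) IP a x := fun x =>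
    (𝔓.contMDiff_act x).mdifferentiableAt (by simp)
  have hsm : MDifferentiableAt IP IP (s ∘ 𝔓.proj) p := hs.comp p (𝔓.mdiff_proj p)
  have h1 := mfderiv_comp (I'' := IP) p (ha ((s ∘ 𝔓.proj) p, h p)) (hsm.prodMk hh)
  have hid : a ∘ (fun q => ((s ∘ 𝔓.proj) q, h q)) =ᶠ[nhds p] id := hq
  rw [hid.mfderiv_eq, mfderiv_id, mfderiv_prodMk hsm hh, mfderiv_comp (I' := IM) p hs (𝔓.mdiff_proj p)] at h1
  have h2 := mfderiv_comp (I'' := IP) (h p) (ha ((s ∘ 𝔓.proj) p, h p))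
    ((mdifferentiableAt_const (c := (s ∘ 𝔓.proj) p)).prodMk (mdifferentiableAt_id (I := IG)))
  rw [show mfderiv IG (IP.prod IG) (fun g : G => ((s ∘ 𝔓.proj) p, g)) (h p) = _ from
    mfderiv_prodMk mdifferentiableAt_const mdifferentiableAt_id, mfderiv_const,
    show mfderiv IG IG (fun g : G => g) (h p) = _ from mfderiv_id] at h2
  have key : ∀ p' : P, p' = p → ∀ g : G, g = 1 → ∀ w : EG,
    (mfderiv IG IP (𝔓.act p') g : EG →L[ℝ] EP) w = (mfderiv IG IP (𝔓.act p) 1 : EG →L[ℝ] EP) w := by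
    rintro _ rfl _ rfl _; rfl
  let X : EG := mfderiv IP IG h p v
  have h3 : v = (mfderiv (IP.prod IG) IP a ((s ∘ 𝔓.proj) p, h p) : EP × EG →L[ℝ] EP)
      ((mfderiv IM IP s (𝔓.proj p) : EM →L[ℝ] EP) (𝔓.Tproj p v : EM), X) := DFunLike.congr_fun h1 v
  have hv' : (𝔓.Tproj p v : EM) = (0 : EM) := hv
  have h4 := DFunLike.congr_fun h2 X
  have h5 : (mfderiv IG IP (𝔓.act (s (𝔓.proj p))) (h p) : EG →L[ℝ] EP) X =
    (mfderiv (IP.prod IG) IP a ((s ∘ 𝔓.proj) p, h p) : EP × EG →L[ℝ] EP) ((0 : EP), X) := h4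
  refine ⟨X, (key _ hsp _ hh1 X).symm.trans (h5.trans (h3.trans ?_).symm)⟩
  have h6 : (mfderiv IM IP s (𝔓.proj p) : EM →L[ℝ] EP) (𝔓.Tproj p v : EM) = (0 : EP) := by
    rw [hv']
    exact map_zero (mfderiv IM IP s (𝔓.proj p) : EM →L[ℝ] EP)
  exact congrArg (fun y : EP => (mfderiv (IP.prod IG) IP a ((s ∘ 𝔓.proj) p, h p) :
    EP × EG →L[ℝ] EP) (y, X)) h6

/-- The action `Φ_{(g,X)}(v) = T κ_g(p) (v + T κ_p(e) X)` on `TP` of the tangent group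
`TG ≅ G ⋉ T_e G`. -/
noncomputable def tangentAct (g : G) (X : TangentSpace IG (1 : G)) (p : P) (v : TangentSpace IP p) :
    TangentSpace IP (𝔓.act p g) :=
  𝔓.Tact g p (v + 𝔓.fund p X)

variable (IG G) in
/-- The adjoint representation: `Ad_g` is the differential at `e` of `h ↦ g h g⁻¹`. -/
noncomputable def Ad (g : G) : TangentSpace IG (1 : G) →L[ℝ] TangentSpace IG (1 : G) :=
  mfderiv IG IG (fun h => g * h * g⁻¹) 1

variable [IsManifold IP ∞ P]

/-- A connection form: a smooth `T_e G`-valued one-form `α` on `P` with `α_p ∘ T κ_p(e) = id` and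
`α_{pg} ∘ T κ_g(p) = Ad_{g⁻¹} ∘ α_p`. Smoothness is that of the function `v ↦ α(v)` on `TP`. -/
structure Connection where
  form : ∀ p : P, TangentSpace IP p →L[ℝ] TangentSpace IG (1 : G)
  smooth : ContMDiff (M' := EG) IP.tangent 𝓘(ℝ, EG) ∞
    (fun v : TangentBundle IP P => form v.proj v.snd)
  form_fund : ∀ p X, form p (𝔓.fund p X) = X
  form_Tact : ∀ p g v, form (𝔓.act p g) (𝔓.Tact g p v) = Ad IG G g⁻¹ (form p v)

namespace Connection
variable {𝔓} [IsManifold IM ∞ M] [LieGroup IG ∞ G] (α : 𝔓.Connection)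

/-- The horizontal subspace `Ker α_p`. -/
noncomputable def hor (p : P) : Submodule ℝ (TangentSpace IP p) := (α.form p).ker

/-- The projection `Π^v_α(p) = T κ_p(e) ∘ α_p` of `T_p P` onto the vertical subspace along the
horizontal one. -/
noncomputable def verticalProj (p : P) : TangentSpace IP p →L[ℝ] TangentSpace IP p :=
  (𝔓.fund p).comp (α.form p)

theorem bijective_Tproj_hor (p : P) :
    Function.Bijective ((𝔓.Tproj p : TangentSpace IP p →ₗ[ℝ] TangentSpace IM (𝔓.proj p)).domRestrict
      (α.hor p)) := by
  constructor
  · rw [injective_iff_map_eq_zero]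
    rintro ⟨v, hv⟩ h
    obtain ⟨X, rfl⟩ := 𝔓.vert_le_range_fund p v h
    have hX : X = 0 := (α.form_fund p X).symm.trans hv
    subst hX
    ext
    exact map_zero _
  · intro w
    obtain ⟨v, rfl⟩ := 𝔓.Tproj_surjective p w
    have h1 : α.form p (v - 𝔓.fund p (α.form p v)) = 0 := by
      rw [map_sub, α.form_fund, sub_self]
    have h2 : 𝔓.Tproj p (v - 𝔓.fund p (α.form p v)) = 𝔓.Tproj p v := by
      rw [map_sub, 𝔓.Tproj_fund, sub_zero]
    exact ⟨⟨v - 𝔓.fund p (α.form p v), h1⟩, h2⟩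

/-- The horizontal lift `Γ_α(p) : T_{μ(p)} M → T_p P`, the inverse of the isomorphism
`T_p μ : Ker α_p → T_{μ(p)} M`. -/
noncomputable def lift (p : P) : TangentSpace IM (𝔓.proj p) →ₗ[ℝ] TangentSpace IP p :=
  (α.hor p).subtype ∘ₗ (LinearEquiv.ofBijective _ (α.bijective_Tproj_hor p)).symm.toLinearMap
end Connection

variable [FiniteDimensional ℝ EP]

/-- The group `Aut_{TG} TP` of those `A ∈ Aut₀ TP` which commute with the action of `TG` on `TP`. -/
def AutTG : Subgroup (∀ p : P, TangentSpace IP p ≃L[ℝ] TangentSpace IP p) where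
  carrier := {A | A ∈ TangentAut IP P ∧ ∀ g X p v,
    A (𝔓.act p g) (𝔓.tangentAct g X p v) = 𝔓.tangentAct g X p (A p v)}
  one_mem' := ⟨one_mem _, fun _ _ _ _ => rfl⟩
  mul_mem' {A B} hA hB := ⟨mul_mem hA.1 hB.1, fun g X p v => by
    change A _ (B _ _) = _
    rw [hB.2, hA.2]
    rfl⟩
  inv_mem' {A} hA := ⟨inv_mem hA.1, fun g X p v => by
    have h := hA.2 g X p ((A p).symm v)
    rw [ContinuousLinearEquiv.apply_symm_apply] at h
    change (A _).symm _ = _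
    rw [ContinuousLinearEquiv.symm_apply_eq]
    exact h.symm⟩

/-- The subgroup `Aut_N TP` of those `A ∈ Aut_{TG} TP` with `A(p) = id + B(p)`,
`B(p) : T_p P → T^v_p P`. -/
def AutN : Subgroup 𝔓.AutTG where
  carrier := {A | ∀ p v, A.1 p v - v ∈ 𝔓.vert p}
  one_mem' := fun p v => by
    change v - v ∈ _
    simp
  mul_mem' {A B} hA hB := fun p v => by
    change A.1 p (B.1 p v) - v ∈ _
    have := add_mem (hA p (B.1 p v)) (hB p v)
    simpa using this
  inv_mem' {A} hA := fun p v => by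
    change (A.1 p).symm v - v ∈ _
    have := neg_mem (hA p ((A.1 p).symm v))
    rw [ContinuousLinearEquiv.apply_symm_apply] at this
    simpa using this

/-- The vector space `End_N TP` of smooth endomorphisms `B` of `TP` covering `id_P` which commute with
the action of `G` and satisfy `Im B(p) ⊂ T^v_p P ⊂ Ker B(p)`. -/
def EndN : Submodule ℝ (∀ p : P, TangentSpace IP p →L[ℝ] TangentSpace IP p) where
  carrier := {B | IsSmoothTangentEndo B ∧
    (∀ p g v, B (𝔓.act p g) (𝔓.Tact g p v) = 𝔓.Tact g p (B p v)) ∧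
    ∀ p, (B p).range ≤ 𝔓.vert p ∧ 𝔓.vert p ≤ (B p).ker}
  zero_mem' := by
    refine ⟨IsSmoothTangentEndo.zero, fun p g v => ?_, fun p => ⟨?_, ?_⟩⟩
    · exact (map_zero _).symm
    · rintro _ ⟨v, rfl⟩; exact zero_mem _
    · intro v _; rfl
  add_mem' {B C} hB hC := by
    refine ⟨hB.1.add hC.1, fun p g v => ?_, fun p => ⟨?_, ?_⟩⟩
    · change B _ _ + C _ _ = 𝔓.Tact g p (B p v + C p v)
      rw [hB.2.1, hC.2.1, map_add]
    · rintro _ ⟨v, rfl⟩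
      exact add_mem ((hB.2.2 p).1 ⟨v, rfl⟩) ((hC.2.2 p).1 ⟨v, rfl⟩)
    · intro v hv
      have h1 : B p v = 0 := (hB.2.2 p).2 hv
      have h2 : C p v = 0 := (hC.2.2 p).2 hv
      change B p v + C p v = 0
      rw [h1, h2, add_zero]
  smul_mem' c B hB := by
    refine ⟨hB.1.const_smul c, fun p g v => ?_, fun p => ⟨?_, ?_⟩⟩
    · change c • B _ _ = 𝔓.Tact g p (c • B p v)
      rw [hB.2.1, map_smul]
    · rintro _ ⟨v, rfl⟩
      exact Submodule.smul_mem _ c ((hB.2.2 p).1 ⟨v, rfl⟩)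
    · intro v hv
      have h1 : B p v = 0 := (hB.2.2 p).2 hv
      change c • B p v = 0
      rw [h1, smul_zero]

end PrincipalBundle
end PB

/- Over a trivializing open set the local section splits `Tμ` smoothly and, through left
translation in `G`, gives a local connection form; a partition of unity on `M` glues these to a
connection.

An element of `Aut_{TG} TP` commutes with the translations `v ↦ v + T_e κ_p X`, so it fixes
vertical vectors. It therefore descends along `Tμ`, and it lies over `id` exactly when it is
`id + B` with `B` vertical-valued and vanishing on vertical vectors; such `B` compose to zero, so
these elements form an additive group. A connection splits the descent homomorphism: `σ_α C` is
the identity on vertical vectors and `C` on horizontal ones. What remains is the algebra of a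
split group extension, where the action of `C` on `B` is computed from
`(id + B) ∘ σ_α C⁻¹ = σ_α C⁻¹ + B ∘ Γ_α ∘ C⁻¹ ∘ Tμ` and from `σ_α C` fixing the values of `B`. -/

section TangentCalculus
variable {𝕜 E H E' H' F K : Type*} [NontriviallyNormedField 𝕜]
  [NormedAddCommGroup E] [NormedSpace 𝕜 E] [TopologicalSpace H]
  [NormedAddCommGroup E'] [NormedSpace 𝕜 E'] [TopologicalSpace H']
  [NormedAddCommGroup F] [NormedSpace 𝕜 F] [TopologicalSpace K]
  {I : ModelWithCorners 𝕜 E H} {I' : ModelWithCorners 𝕜 E' H'} {J : ModelWithCorners 𝕜 F K}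
  {X Y N : Type*} [TopologicalSpace X] [ChartedSpace H X] [TopologicalSpace Y] [ChartedSpace H' Y]
  [TopologicalSpace N] [ChartedSpace K N] {m n : WithTop ℕ∞}

theorem tangentSpace_clm_apply_congr {x y : X} (h : x = y)
    (φ : ∀ x : X, TangentSpace I x →L[𝕜] E') (w : E) :
    (φ x : E →L[𝕜] E') w = (φ y : E →L[𝕜] E') w := by
  subst h; rfl

theorem tangentBundle_mk_congr {x y : X} (h : x = y) {v w : E} (hv : v = w) :
    (⟨x, v⟩ : TangentBundle I X) = ⟨y, w⟩ := by
  subst h hv; rfl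

theorem mfderiv_apply_mfderiv_of_eventually_leftInverse {f : X → Y} {g : Y → X} {x : X}
    (hg : MDifferentiableAt I' I g (f x)) (hf : MDifferentiableAt I I' f x)
    (h : ∀ᶠ y in nhds x, g (f y) = y) (v : TangentSpace I x) :
    (mfderiv I' I g (f x) : E' →L[𝕜] E) (mfderiv I I' f x v : E') = v := by
  have hcomp := mfderiv_comp_apply (I'' := I) x hg hf v
  have hid : g ∘ f =ᶠ[nhds x] id := h
  rw [hid.mfderiv_eq, mfderiv_id] at hcomp
  exact hcomp.symm

theorem contMDiffAt_mfderiv_apply [IsManifold I 1 X] [IsManifold I' 1 Y] [IsManifold J 1 N]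
    {f : N → X → Y} {V : N → TangentBundle I X} {k₀ : N}
    (hf : ContMDiffAt (J.prod I) I' n (Function.uncurry f) (k₀, (V k₀).proj))
    (hV : ContMDiffAt J I.tangent m V k₀) (hmn : m + 1 ≤ n) :
    ContMDiffAt J I'.tangent m (fun k => (⟨f k (V k).proj,
      mfderiv I I' (f k) (V k).proj (V k).snd⟩ : TangentBundle I' Y)) k₀ := by
  have hbase : ContMDiffAt J I m (fun k => (V k).proj) k₀ := (contMDiffAt_totalSpace.1 hV).1
  have hderiv := ContMDiffAt.mfderiv f (fun k => (V k).proj) hf hbase hmn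
  exact ContMDiffAt.clm_apply_of_inCoordinates (E₁ := (TangentSpace I : X → Type _))
    (E₂ := (TangentSpace I' : Y → Type _)) (v := fun k => (V k).snd) hderiv hV
    (ContMDiffAt.comp (g := Function.uncurry f) k₀ (hf.of_le (le_self_add.trans hmn))
      (contMDiffAt_id.prodMk hbase))

theorem contMDiffAt_totalSpace_mk_add {E₁ : X → Type*} [∀ x, AddCommMonoid (E₁ x)]
    [∀ x, Module 𝕜 (E₁ x)] [TopologicalSpace (TotalSpace E' E₁)] [∀ x, TopologicalSpace (E₁ x)]
    [FiberBundle E' E₁] [VectorBundle 𝕜 E' E₁] {b : N → X} {V W : ∀ k, E₁ (b k)} {k₀ : N}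
    (hV : ContMDiffAt J (I.prod 𝓘(𝕜, E')) n (fun k => TotalSpace.mk' E' (b k) (V k)) k₀)
    (hW : ContMDiffAt J (I.prod 𝓘(𝕜, E')) n (fun k => TotalSpace.mk' E' (b k) (W k)) k₀) :
    ContMDiffAt J (I.prod 𝓘(𝕜, E')) n (fun k => TotalSpace.mk' E' (b k) (V k + W k)) k₀ := by
  rw [contMDiffAt_totalSpace] at *
  refine ⟨hV.1, (hV.2.add hW.2).congr_of_eventuallyEq ?_⟩
  let e := trivializationAt E' E₁ (b k₀)
  have hmem : ∀ᶠ k in nhds k₀, b k ∈ e.baseSet := hV.1.continuousAt.eventually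
    (e.open_baseSet.mem_nhds (mem_baseSet_trivializationAt E' E₁ (b k₀)))
  filter_upwards [hmem] with k hk
  exact (e.linear 𝕜 hk).map_add (V k) (W k)

theorem contMDiffAt_tangentBundle_mk_const_iff [IsManifold I 1 X] {x : X} {V : N → E} {k₀ : N} :
    ContMDiffAt J I.tangent n (fun k => (⟨x, V k⟩ : TangentBundle I X)) k₀ ↔
      ContMDiffAt J 𝓘(𝕜, E) n V k₀ := by
  rw [contMDiffAt_totalSpace]
  let φ : E ≃L[𝕜] E := (trivializationAt E (TangentSpace I) x).continuousLinearEquivAt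
    𝕜 x (mem_baseSet_trivializationAt E (TangentSpace I) x)
  refine ⟨fun h => ?_, fun h => ⟨contMDiffAt_const,
    φ.toContinuousLinearMap.contMDiff.contMDiffAt.comp k₀ h⟩⟩
  refine (φ.symm.toContinuousLinearMap.contMDiff.contMDiffAt.comp k₀ h.2).congr_of_eventuallyEq
    (Filter.Eventually.of_forall fun k => ?_)
  exact (φ.symm_apply_apply (V k)).symm

end TangentCalculus

section PartitionOfUnity
variable {E H E' H' F : Type*} [NormedAddCommGroup E] [NormedSpace ℝ E] [TopologicalSpace H]
  [NormedAddCommGroup E'] [NormedSpace ℝ E'] [TopologicalSpace H']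
  [NormedAddCommGroup F] [NormedSpace ℝ F]
  {I : ModelWithCorners ℝ E H} {I' : ModelWithCorners ℝ E' H'}
  {X Y ι : Type*} [TopologicalSpace X] [ChartedSpace H X] [TopologicalSpace Y] [ChartedSpace H' Y]

theorem contMDiff_partitionOfUnity_finsum {s : Set Y} (ρ : SmoothPartitionOfUnity ι I' Y s)
    {f : X → Y} (hf : ContMDiff I I' ∞ f) {g : ι → X → F}
    (hg : ∀ i x, f x ∈ tsupport (ρ i) → ContMDiffAt I 𝓘(ℝ, F) ∞ (g i) x) :
    ContMDiff I 𝓘(ℝ, F) ∞ (fun x => ∑ᶠ i, ρ i (f x) • g i x) := by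
  have hfin : LocallyFinite fun i => Function.support fun x => ρ i (f x) :=
    ρ.locallyFinite.preimage_continuous hf.continuous
  refine contMDiff_finsum (fun i x => ?_)
    (hfin.subset fun i => Function.support_smul_subset_left _ (g i))
  by_cases hx : f x ∈ tsupport (ρ i)
  · exact ((ρ i).contMDiff.comp hf x).smul (hg i x hx)
  · refine (contMDiffAt_const (c := (0 : F))).congr_of_eventuallyEq ?_
    filter_upwards [hf.continuous.continuousAt.eventually
      ((isClosed_tsupport (ρ i)).isOpen_compl.mem_nhds hx)] with y hy
    rw [image_eq_zero_of_notMem_tsupport hy, zero_smul]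

end PartitionOfUnity

section SplitExtension
variable {N E Q : Type*} [Group N] [Group E] [Group Q] {S : GroupExtension N E Q}
  (s : S.Splitting)

/-- The kernel component `n` of the decomposition `e = inl n * s q` of an element `e` of a split
group extension. It is a map of sets; its failure to be a homomorphism is `inl_kernelPart_mul`. -/
noncomputable def kernelPart (e : E) : N := (s.semidirectProductMulEquiv.symm e).left

theorem inl_kernelPart (e : E) : S.inl (kernelPart s e) = e * (s (S.rightHom e))⁻¹ :=
  eq_mul_inv_of_mul_eq (s.semidirectProductMulEquiv.apply_symm_apply e)

theorem kernelPart_inl (n : N) : kernelPart s (S.inl n) = n := by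
  apply S.inl_injective
  rw [inl_kernelPart, S.rightHom_inl, map_one, inv_one, mul_one]

theorem kernelPart_eq_one_iff {e : E} : kernelPart s e = 1 ↔ e ∈ s.toMonoidHom.range := by
  rw [← map_eq_one_iff S.inl S.inl_injective, inl_kernelPart, mul_inv_eq_one]
  constructor
  · exact fun h => ⟨S.rightHom e, h.symm⟩
  · rintro ⟨q, rfl⟩
    exact congrArg s (s.rightHom_splitting q).symm

theorem inl_kernelPart_mul (e₁ e₂ : E) : S.inl (kernelPart s (e₁ * e₂)) =
    S.inl (kernelPart s e₁) * s (S.rightHom e₁) * S.inl (kernelPart s e₂) *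
      (s (S.rightHom e₁))⁻¹ := by
  simp only [inl_kernelPart, map_mul]
  group

end SplitExtension

section SmoothEndomorphisms
variable {E H X : Type*} [NormedAddCommGroup E] [NormedSpace ℝ E] [TopologicalSpace H]
  {I : ModelWithCorners ℝ E H} [TopologicalSpace X] [ChartedSpace H X] [IsManifold I ∞ X]

theorem IsSmoothTangentEndo.id :
    IsSmoothTangentEndo (fun x : X => ContinuousLinearMap.id ℝ (TangentSpace I x)) :=
  contMDiff_id

theorem IsSmoothTangentEndo.sub {B C : ∀ x : X, TangentSpace I x →L[ℝ] TangentSpace I x}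
    (hB : IsSmoothTangentEndo B) (hC : IsSmoothTangentEndo C) :
    IsSmoothTangentEndo (fun x => B x - C x) := by
  simpa only [sub_eq_add_neg, neg_one_smul] using hB.add (hC.const_smul (-1))

theorem TangentAut.ext [FiniteDimensional ℝ E] {C D : TangentAut I X}
    (h : ∀ x v, C.1 x v = D.1 x v) : C = D :=
  Subtype.ext (funext fun x => ContinuousLinearEquiv.ext (funext (h x)))

end SmoothEndomorphisms

namespace PrincipalBundle
variable {EM HM EG HG EP HP : Type*}
  [NormedAddCommGroup EM] [NormedSpace ℝ EM] [TopologicalSpace HM]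
  [NormedAddCommGroup EG] [NormedSpace ℝ EG] [TopologicalSpace HG]
  [NormedAddCommGroup EP] [NormedSpace ℝ EP] [TopologicalSpace HP]
  {IM : ModelWithCorners ℝ EM HM} {IG : ModelWithCorners ℝ EG HG} {IP : ModelWithCorners ℝ EP HP}
  {M G P : Type*} [TopologicalSpace M] [ChartedSpace HM M]
  [TopologicalSpace G] [ChartedSpace HG G] [Group G] [TopologicalSpace P] [ChartedSpace HP P]
  (𝔓 : PrincipalBundle IM IG IP M G P)

theorem act_act_inv (p : P) (g : G) : 𝔓.act (𝔓.act p g) g⁻¹ = p := by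
  rw [← 𝔓.act_mul, mul_inv_cancel, 𝔓.act_one]

theorem mdiff_act_fst (g : G) (p : P) : MDifferentiableAt IP IP (fun q => 𝔓.act q g) p :=
  ((𝔓.contMDiff_act.comp (contMDiff_id.prodMk contMDiff_const)) p).mdifferentiableAt (by simp)

theorem Tproj_Tact (p : P) (g : G) (v : TangentSpace IP p) :
    (𝔓.Tproj (𝔓.act p g) (𝔓.Tact g p v) : EM) = 𝔓.Tproj p v := by
  have hcomp := mfderiv_comp_apply (I'' := IM) p (𝔓.mdiff_proj (𝔓.act p g))
    (𝔓.mdiff_act_fst g p) v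
  have hproj : 𝔓.proj ∘ (fun q => 𝔓.act q g) = 𝔓.proj := funext fun q => 𝔓.proj_act q g
  rw [hproj] at hcomp
  exact hcomp.symm

theorem Tact_injective (g : G) (p : P) : Function.Injective (𝔓.Tact g p) :=
  Function.LeftInverse.injective
    (g := (mfderiv IP IP (fun q => 𝔓.act q g⁻¹) (𝔓.act p g) : EP →L[ℝ] EP))
    (mfderiv_apply_mfderiv_of_eventually_leftInverse (𝔓.mdiff_act_fst g⁻¹ (𝔓.act p g))
      (𝔓.mdiff_act_fst g p) (Filter.Eventually.of_forall fun q => 𝔓.act_act_inv q g))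

theorem contMDiffAt_fund [LieGroup IG ∞ G] [IsManifold IP ∞ P] {E₀ H₀ N : Type*}
    [NormedAddCommGroup E₀] [NormedSpace ℝ E₀] [TopologicalSpace H₀]
    {J : ModelWithCorners ℝ E₀ H₀} [TopologicalSpace N] [ChartedSpace H₀ N] [IsManifold J 1 N]
    {b : N → P} {Y : N → TangentSpace IG (1 : G)} {k₀ : N} (hb : ContMDiffAt J IP ∞ b k₀)
    (hY : ContMDiffAt (M' := EG) J 𝓘(ℝ, EG) ∞ Y k₀) :
    ContMDiffAt J IP.tangent ∞
      (fun k => (⟨b k, 𝔓.fund (b k) (Y k)⟩ : TangentBundle IP P)) k₀ := by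
  have hact : ContMDiffAt (J.prod IG) IP ∞ (fun x : N × G => 𝔓.act (b x.1) x.2) (k₀, 1) :=
    𝔓.contMDiff_act.contMDiffAt.comp (k₀, (1 : G))
      ((ContMDiffAt.comp (g := b) (k₀, (1 : G)) hb contMDiffAt_fst).prodMk contMDiffAt_snd)
  have hderiv := contMDiffAt_mfderiv_apply (n := ∞) (f := fun k g => 𝔓.act (b k) g)
    (V := fun k => (⟨1, Y k⟩ : TangentBundle IG G)) (I' := IP) hact
    (contMDiffAt_tangentBundle_mk_const_iff.2 hY) (by simp)
  refine hderiv.congr_of_eventuallyEq (Filter.Eventually.of_forall fun k => ?_)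
  exact tangentBundle_mk_congr (𝔓.act_one (b k)).symm rfl

/-- A local trivialization `μ⁻¹(U) ≃ U × G` of the principal bundle, recorded through its unit
section `s : U → P` and its fibre coordinate `c : μ⁻¹(U) → G`, which satisfy `p = s(μ(p)) c(p)`.
The maps are total; their values outside `U` and `μ⁻¹(U)` are irrelevant. -/
structure LocalTrivialization where
  baseSet : Set M
  sec : M → P
  coord : P → G
  isOpen_baseSet : IsOpen baseSet
  contMDiffAt_sec : ∀ m ∈ baseSet, ContMDiffAt IM IP ∞ sec m
  contMDiffAt_coord : ∀ p, 𝔓.proj p ∈ baseSet → ContMDiffAt IP IG ∞ coord p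
  proj_sec : ∀ m ∈ baseSet, 𝔓.proj (sec m) = m
  coord_act : ∀ p g, 𝔓.proj p ∈ baseSet → coord (𝔓.act p g) = coord p * g
  act_sec_coord : ∀ p, 𝔓.proj p ∈ baseSet → 𝔓.act (sec (𝔓.proj p)) (coord p) = p

theorem exists_localTrivialization (m : M) : ∃ τ : 𝔓.LocalTrivialization, m ∈ τ.baseSet := by
  obtain ⟨U, e, hU, hm, hs, ht, he, hes, he1, hea⟩ := 𝔓.exists_trivialization m
  have mem_source : ∀ p, 𝔓.proj p ∈ U → p ∈ e.source := fun p hp => by rwa [hs]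
  have mem_target : ∀ m ∈ U, (m, (1 : G)) ∈ e.target := fun m hm => by
    rw [ht]; exact ⟨hm, mem_univ _⟩
  have proj_sec : ∀ m ∈ U, 𝔓.proj (e.symm (m, 1)) = m := fun m hm => by
    rw [← he1 _ (e.map_target (mem_target m hm)), e.right_inv (mem_target m hm)]
  refine ⟨{ baseSet := U, sec := fun m => e.symm (m, 1), coord := fun p => (e p).2,
            isOpen_baseSet := hU, proj_sec, contMDiffAt_sec := fun m hm => ?_,
            contMDiffAt_coord := fun p hp => ?_, coord_act := fun p g hp => ?_,
            act_sec_coord := fun p hp => ?_ }, hm⟩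
  · exact ContMDiffAt.comp (g := e.symm) (f := fun m => (m, (1 : G))) m
      ((hes _ (mem_target m hm)).contMDiffAt (e.open_target.mem_nhds (mem_target m hm)))
      (contMDiffAt_id.prodMk contMDiffAt_const)
  · exact contMDiffAt_snd.comp p
      ((he p (mem_source p hp)).contMDiffAt (e.open_source.mem_nhds (mem_source p hp)))
  · rw [hea p (mem_source p hp)]
  · have hsec := proj_sec _ hp
    refine e.injOn (mem_source _ ?_) (mem_source p hp) ?_
    · rwa [𝔓.proj_act, hsec]
    · rw [hea _ (e.map_target (mem_target _ hp)), e.right_inv (mem_target _ hp), one_mul,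
        ← he1 p (mem_source p hp)]

theorem proj_surjective : Function.Surjective 𝔓.proj := fun m => by
  obtain ⟨τ, hτ⟩ := 𝔓.exists_localTrivialization m
  exact ⟨τ.sec m, τ.proj_sec m hτ⟩

theorem exists_act_eq {p q : P} (h : 𝔓.proj p = 𝔓.proj q) : ∃ g, 𝔓.act p g = q := by
  obtain ⟨τ, hp⟩ := 𝔓.exists_localTrivialization (𝔓.proj p)
  refine ⟨(τ.coord p)⁻¹ * τ.coord q, ?_⟩
  calc 𝔓.act p ((τ.coord p)⁻¹ * τ.coord q)
      = 𝔓.act (𝔓.act (τ.sec (𝔓.proj p)) (τ.coord p)) ((τ.coord p)⁻¹ * τ.coord q) := by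
        rw [τ.act_sec_coord p hp]
    _ = 𝔓.act (τ.sec (𝔓.proj q)) (τ.coord q) := by rw [← 𝔓.act_mul, mul_inv_cancel_left, h]
    _ = q := τ.act_sec_coord q (h ▸ hp)

namespace LocalTrivialization
variable {𝔓} (τ : 𝔓.LocalTrivialization)

/-- The translate `m ↦ s(m) c(p)` of the unit section which passes through `p`. -/
def sectionThrough (p : P) (m : M) : P := 𝔓.act (τ.sec m) (τ.coord p)

theorem sectionThrough_proj {p : P} (hp : 𝔓.proj p ∈ τ.baseSet) :
    τ.sectionThrough p (𝔓.proj p) = p :=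
  τ.act_sec_coord p hp

theorem proj_sectionThrough (p : P) {m : M} (hm : m ∈ τ.baseSet) :
    𝔓.proj (τ.sectionThrough p m) = m :=
  (𝔓.proj_act _ _).trans (τ.proj_sec m hm)

theorem contMDiffAt_sectionThrough {E₀ H₀ N : Type*} [NormedAddCommGroup E₀] [NormedSpace ℝ E₀]
    [TopologicalSpace H₀] {J : ModelWithCorners ℝ E₀ H₀} [TopologicalSpace N] [ChartedSpace H₀ N]
    {b : N → P} {k₀ : N} {m : M} (hb : ContMDiffAt J IP ∞ b k₀)
    (hk₀ : 𝔓.proj (b k₀) ∈ τ.baseSet) (hm : m ∈ τ.baseSet) :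
    ContMDiffAt (J.prod IM) IP ∞
      (Function.uncurry fun k m => τ.sectionThrough (b k) m) (k₀, m) := by
  have hcoord : ContMDiffAt J IG ∞ (fun k => τ.coord (b k)) k₀ :=
    (τ.contMDiffAt_coord _ hk₀).comp k₀ hb
  have hsec := (τ.contMDiffAt_sec m hm).comp (k₀, m) (contMDiffAt_snd (I := J) (J := IM))
  exact (𝔓.contMDiff_act (τ.sec m, τ.coord (b k₀))).comp (k₀, m)
    (hsec.prodMk (hcoord.comp (k₀, m) contMDiffAt_fst))

/-- The right inverse `T_{μ(p)} M → T_p P` of `T_p μ` given by the differential of the section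
through `p`. It is meaningful only for `μ(p) ∈ U`. -/
noncomputable def tangentLift (p : P) : TangentSpace IM (𝔓.proj p) →L[ℝ] TangentSpace IP p :=
  (mfderiv IM IP (τ.sectionThrough p) (𝔓.proj p) : EM →L[ℝ] EP)

theorem Tproj_tangentLift {p : P} (hp : 𝔓.proj p ∈ τ.baseSet) (w : TangentSpace IM (𝔓.proj p)) :
    𝔓.Tproj p (τ.tangentLift p w) = w := by
  have hsec : MDifferentiableAt IM IP (τ.sectionThrough p) (𝔓.proj p) :=
    ((τ.contMDiffAt_sectionThrough (J := IP) contMDiffAt_id hp hp).comp (𝔓.proj p)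
      (contMDiffAt_const.prodMk contMDiffAt_id)).mdifferentiableAt (by simp)
  have hinv := mfderiv_apply_mfderiv_of_eventually_leftInverse (𝔓.mdiff_proj _) hsec
    (Filter.mem_of_superset (τ.isOpen_baseSet.mem_nhds hp) fun _ => τ.proj_sectionThrough p) w
  exact (tangentSpace_clm_apply_congr (τ.sectionThrough_proj hp) 𝔓.Tproj _).symm.trans hinv

theorem contMDiffAt_tangentLift [IsManifold IM ∞ M] [IsManifold IP ∞ P] {E₀ H₀ N : Type*}
    [NormedAddCommGroup E₀] [NormedSpace ℝ E₀] [TopologicalSpace H₀]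
    {J : ModelWithCorners ℝ E₀ H₀} [TopologicalSpace N] [ChartedSpace H₀ N] [IsManifold J 1 N]
    {b : N → P} {W : ∀ k, TangentSpace IM (𝔓.proj (b k))} {k₀ : N}
    (hb : ContMDiffAt J IP ∞ b k₀) (hk₀ : 𝔓.proj (b k₀) ∈ τ.baseSet)
    (hW : ContMDiffAt J IM.tangent ∞ (fun k => (⟨𝔓.proj (b k), W k⟩ : TangentBundle IM M)) k₀) :
    ContMDiffAt J IP.tangent ∞
      (fun k => (⟨b k, τ.tangentLift (b k) (W k)⟩ : TangentBundle IP P)) k₀ := by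
  have hderiv := contMDiffAt_mfderiv_apply (n := ∞)
    (τ.contMDiffAt_sectionThrough hb hk₀ hk₀) hW (by simp)
  refine hderiv.congr_of_eventuallyEq ?_
  have hnear : ∀ᶠ k in nhds k₀, 𝔓.proj (b k) ∈ τ.baseSet :=
    (𝔓.contMDiff_proj.continuous.continuousAt.comp hb.continuousAt).eventually
      (τ.isOpen_baseSet.mem_nhds hk₀)
  filter_upwards [hnear] with k hk
  exact tangentBundle_mk_congr (τ.sectionThrough_proj hk).symm rfl

/-- The left logarithmic differential of the fibre coordinate: the connection form of the product
connection over `U`. It is meaningful only for `μ(p) ∈ U`. -/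
noncomputable def form (p : P) : TangentSpace IP p →L[ℝ] TangentSpace IG (1 : G) :=
  (mfderiv IP IG (fun q => (τ.coord p)⁻¹ * τ.coord q) p : EP →L[ℝ] EG)

theorem mdiff_mul_coord [LieGroup IG ∞ G] (g : G) {p : P} (hp : 𝔓.proj p ∈ τ.baseSet) :
    MDifferentiableAt IP IG (fun q => g * τ.coord q) p :=
  (contMDiffAt_const.mul (τ.contMDiffAt_coord p hp)).mdifferentiableAt (by simp)

theorem contMDiffAt_form [LieGroup IG ∞ G] [IsManifold IP ∞ P] {v : TangentBundle IP P}
    (hv : 𝔓.proj v.proj ∈ τ.baseSet) : ContMDiffAt (M' := EG) IP.tangent 𝓘(ℝ, EG) ∞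
      (fun w : TangentBundle IP P => τ.form w.proj w.snd) v := by
  have hcoord := τ.contMDiffAt_coord v.proj hv
  have hbase := hcoord.comp v (contMDiffAt_proj (TangentSpace IP))
  have hderiv := contMDiffAt_mfderiv_apply (m := ∞) (n := ∞) (V := id)
    (f := fun (w : TangentBundle IP P) q => (τ.coord w.proj)⁻¹ * τ.coord q)
    ((hbase.comp (v, v.proj) contMDiffAt_fst).inv.mul (hcoord.comp (v, v.proj) contMDiffAt_snd))
    contMDiffAt_id (by simp)
  refine (contMDiffAt_tangentBundle_mk_const_iff (x := (1 : G))).1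
    (hderiv.congr_of_eventuallyEq (Filter.Eventually.of_forall fun w => ?_))
  exact tangentBundle_mk_congr (inv_mul_cancel _).symm rfl

theorem form_fund [LieGroup IG ∞ G] [IsManifold IP ∞ P] {p : P} (hp : 𝔓.proj p ∈ τ.baseSet)
    (X : TangentSpace IG (1 : G)) : τ.form p (𝔓.fund p X) = X := by
  have hact : 𝔓.proj (𝔓.act p 1) ∈ τ.baseSet := by rwa [𝔓.proj_act]
  have hcomp := mfderiv_comp_apply (I'' := IG) (1 : G)
    (τ.mdiff_mul_coord (τ.coord p)⁻¹ hact) (𝔓.mdiff_act_snd p 1) X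
  have hid : (fun q => (τ.coord p)⁻¹ * τ.coord q) ∘ 𝔓.act p = id :=
    funext fun g => by simp [τ.coord_act p g hp]
  rw [hid, mfderiv_id] at hcomp
  exact (tangentSpace_clm_apply_congr (𝔓.act_one p).symm
    (fun q => (mfderiv IP IG (fun q => (τ.coord p)⁻¹ * τ.coord q) q : EP →L[ℝ] EG)) _).trans
    hcomp.symm

theorem form_Tact [LieGroup IG ∞ G] {p : P} (hp : 𝔓.proj p ∈ τ.baseSet) (g : G)
    (v : TangentSpace IP p) : τ.form (𝔓.act p g) (𝔓.Tact g p v) = Ad IG G g⁻¹ (τ.form p v) := by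
  have hact : 𝔓.proj (𝔓.act p g) ∈ τ.baseSet := by rwa [𝔓.proj_act]
  have hconj (x : G) : MDifferentiableAt IG IG (fun x => g⁻¹ * x * g⁻¹⁻¹) x :=
    ((contMDiff_const.mul contMDiff_id).mul contMDiff_const).mdifferentiableAt
      (n := ∞) (by simp)
  have hcomm : (fun q => (τ.coord (𝔓.act p g))⁻¹ * τ.coord q) ∘ (fun q => 𝔓.act q g) =ᶠ[nhds p]
      (fun x => g⁻¹ * x * g⁻¹⁻¹) ∘ (fun q => (τ.coord p)⁻¹ * τ.coord q) := by
    filter_upwards [𝔓.contMDiff_proj.continuous.continuousAt.eventually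
      (τ.isOpen_baseSet.mem_nhds hp)] with q hq
    simp [τ.coord_act p g hp, τ.coord_act q g hq, mul_assoc]
  have hleft := mfderiv_comp_apply (I'' := IG) p (τ.mdiff_mul_coord (τ.coord (𝔓.act p g))⁻¹ hact)
    (𝔓.mdiff_act_fst g p) v
  have hright := mfderiv_comp_apply (I'' := IG) p (hconj _)
    (τ.mdiff_mul_coord (τ.coord p)⁻¹ hp) v
  rw [hcomm.mfderiv_eq] at hleft
  exact (hleft.symm.trans hright).trans (tangentSpace_clm_apply_congr (inv_mul_cancel (τ.coord p))
    (fun x => (mfderiv IG IG (fun x => g⁻¹ * x * g⁻¹⁻¹) x : EG →L[ℝ] EG)) _)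

end LocalTrivialization

/-- The connections over an open set `U`: the form `a`, of which only the values over `μ⁻¹(U)` are
constrained, satisfies there the axioms of `Connection`. -/
structure IsConnectionFormOn [IsManifold IP ∞ P]
    (a : ∀ p : P, TangentSpace IP p →L[ℝ] TangentSpace IG (1 : G)) (U : Set M) : Prop where
  contMDiffAt : ∀ v : TangentBundle IP P, 𝔓.proj v.proj ∈ U →
    ContMDiffAt (M' := EG) IP.tangent 𝓘(ℝ, EG) ∞
      (fun w : TangentBundle IP P => a w.proj w.snd) v
  apply_fund : ∀ p, 𝔓.proj p ∈ U → ∀ X, a p (𝔓.fund p X) = X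
  apply_Tact : ∀ p, 𝔓.proj p ∈ U → ∀ g v,
    a (𝔓.act p g) (𝔓.Tact g p v) = Ad IG G g⁻¹ (a p v)

namespace IsConnectionFormOn
variable {𝔓} {ι : Type*} {ρ : SmoothPartitionOfUnity ι IM M univ}
  {a : ι → ∀ p : P, TangentSpace IP p →L[ℝ] TangentSpace IG (1 : G)} {U : ι → Set M}

theorem sum_apply_fund [IsManifold IP ∞ P] (ha : ∀ i, 𝔓.IsConnectionFormOn (a i) (U i))
    (hρ : ρ.IsSubordinate U) (p : P) (X : TangentSpace IG (1 : G)) :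
    ∑ i ∈ ρ.finsupport (𝔓.proj p), ρ i (𝔓.proj p) • a i p (𝔓.fund p X) = X := by
  calc ∑ i ∈ ρ.finsupport (𝔓.proj p), ρ i (𝔓.proj p) • a i p (𝔓.fund p X)
      = ∑ i ∈ ρ.finsupport (𝔓.proj p), ρ i (𝔓.proj p) • X :=
        Finset.sum_congr rfl fun i hi => by
          rw [(ha i).apply_fund p (hρ i (subset_tsupport _ ((ρ.mem_finsupport _).1 hi)))]
    _ = X := by rw [← Finset.sum_smul, ρ.sum_finsupport _ (mem_univ _), one_smul]

theorem sum_apply_Tact [IsManifold IP ∞ P] (ha : ∀ i, 𝔓.IsConnectionFormOn (a i) (U i))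
    (hρ : ρ.IsSubordinate U) (p : P) (g : G) (v : TangentSpace IP p) :
    ∑ i ∈ ρ.finsupport (𝔓.proj (𝔓.act p g)),
        ρ i (𝔓.proj (𝔓.act p g)) • a i (𝔓.act p g) (𝔓.Tact g p v) =
      Ad IG G g⁻¹ (∑ i ∈ ρ.finsupport (𝔓.proj p), ρ i (𝔓.proj p) • a i p v) := by
  rw [𝔓.proj_act, map_sum]
  refine Finset.sum_congr rfl fun i hi => ?_
  rw [(ha i).apply_Tact p (hρ i (subset_tsupport _ ((ρ.mem_finsupport _).1 hi))), map_smul]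

theorem contMDiff_sum [IsManifold IP ∞ P] (ha : ∀ i, 𝔓.IsConnectionFormOn (a i) (U i))
    (hρ : ρ.IsSubordinate U) : ContMDiff (M' := EG) IP.tangent 𝓘(ℝ, EG) ∞
      (fun v : TangentBundle IP P =>
        ∑ i ∈ ρ.finsupport (𝔓.proj v.proj), ρ i (𝔓.proj v.proj) • a i v.proj v.snd) := by
  have hproj : ContMDiff IP.tangent IM ∞ (fun v : TangentBundle IP P => 𝔓.proj v.proj) :=
    𝔓.contMDiff_proj.comp (Bundle.contMDiff_proj (TangentSpace IP))
  refine (contMDiff_partitionOfUnity_finsum (F := EG) ρ hproj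
    (g := fun i v => a i v.proj v.snd) fun i v hv => (ha i).contMDiffAt v (hρ i hv)).congr
    fun v => ?_
  exact ρ.sum_finsupport_smul_eq_finsum (x₀ := 𝔓.proj v.proj) fun i _ => (a i v.proj v.snd : EG)

end IsConnectionFormOn

variable {𝔓} in
theorem LocalTrivialization.isConnectionFormOn_form [LieGroup IG ∞ G] [IsManifold IP ∞ P]
    (τ : 𝔓.LocalTrivialization) : 𝔓.IsConnectionFormOn τ.form τ.baseSet :=
  ⟨fun _ => τ.contMDiffAt_form, fun _ => τ.form_fund, fun _ => τ.form_Tact⟩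

theorem nonempty_connection [FiniteDimensional ℝ EM] [IsManifold IM ∞ M] [T2Space M]
    [SecondCountableTopology M] [LieGroup IG ∞ G] [IsManifold IP ∞ P] :
    Nonempty 𝔓.Connection := by
  have : LocallyCompactSpace HM := IM.locallyCompactSpace
  have : LocallyCompactSpace M := ChartedSpace.locallyCompactSpace HM M
  choose τ hτ using 𝔓.exists_localTrivialization
  obtain ⟨ρ, hρ⟩ := SmoothPartitionOfUnity.exists_isSubordinate IM isClosed_univ
    (fun m => (τ m).baseSet) (fun m => (τ m).isOpen_baseSet) fun m _ => mem_iUnion.2 ⟨m, hτ m⟩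
  have hτ_form : ∀ m, 𝔓.IsConnectionFormOn (τ m).form (τ m).baseSet :=
    fun m => (τ m).isConnectionFormOn_form
  let form (p : P) : TangentSpace IP p →L[ℝ] TangentSpace IG (1 : G) :=
    ∑ m ∈ ρ.finsupport (𝔓.proj p), ρ m (𝔓.proj p) • (τ m).form p
  have form_apply (p : P) (v : TangentSpace IP p) : form p v =
      ∑ m ∈ ρ.finsupport (𝔓.proj p), ρ m (𝔓.proj p) • (τ m).form p v :=
    sum_apply _ _ v
  exact ⟨{
    form
    smooth := (IsConnectionFormOn.contMDiff_sum hτ_form hρ).congr fun v => form_apply v.proj v.snd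
    form_fund := fun p X =>
      (form_apply p _).trans (IsConnectionFormOn.sum_apply_fund hτ_form hρ p X)
    form_Tact := fun p g v => by
      rw [form_apply, form_apply, IsConnectionFormOn.sum_apply_Tact hτ_form hρ] }⟩

namespace AutTG
variable [IsManifold IP ∞ P] [FiniteDimensional ℝ EP] {𝔓}

theorem ext {A B : 𝔓.AutTG} (h : ∀ p v, A.1 p v = B.1 p v) : A = B :=
  Subtype.ext (funext fun p => ContinuousLinearEquiv.ext (funext (h p)))

theorem apply_Tact (A : 𝔓.AutTG) (g : G) (p : P) (v : TangentSpace IP p) :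
    A.1 (𝔓.act p g) (𝔓.Tact g p v) = 𝔓.Tact g p (A.1 p v) := by
  simpa only [tangentAct, map_zero, add_zero] using A.2.2 g 0 p v

theorem apply_fund (A : 𝔓.AutTG) (p : P) (X : TangentSpace IG (1 : G)) :
    A.1 p (𝔓.fund p X) = 𝔓.fund p X := by
  have h := A.2.2 1 X p 0
  simp only [tangentAct, zero_add, map_zero, apply_Tact] at h
  exact 𝔓.Tact_injective _ _ h

theorem apply_of_Tproj_eq_zero [IsManifold IM ∞ M] [LieGroup IG ∞ G] (A : 𝔓.AutTG) {p : P}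
    {v : TangentSpace IP p} (hv : 𝔓.Tproj p v = 0) : A.1 p v = v := by
  obtain ⟨X, rfl⟩ := 𝔓.vert_le_range_fund p v hv
  exact apply_fund A p X

theorem mem_of_apply_Tact_of_apply_fund
    {A : ∀ p : P, TangentSpace IP p ≃L[ℝ] TangentSpace IP p}
    (hA : IsSmoothTangentEndo (fun p => (A p : TangentSpace IP p →L[ℝ] TangentSpace IP p)))
    (hact : ∀ p g v, A (𝔓.act p g) (𝔓.Tact g p v) = 𝔓.Tact g p (A p v))
    (hfund : ∀ p X, A p (𝔓.fund p X) = 𝔓.fund p X) : A ∈ 𝔓.AutTG :=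
  ⟨hA, fun g X p v => by simp only [tangentAct, hact, map_add, hfund]⟩

theorem sub_id_mem_EndN [IsManifold IM ∞ M] [LieGroup IG ∞ G] {A : 𝔓.AutTG} (hA : A ∈ 𝔓.AutN) :
    (fun p => (A.1 p : TangentSpace IP p →L[ℝ] TangentSpace IP p) - ContinuousLinearMap.id ℝ _)
      ∈ 𝔓.EndN := by
  refine ⟨IsSmoothTangentEndo.sub A.2.1 IsSmoothTangentEndo.id, fun p g v => ?_,
    fun p => ⟨?_, fun v hv => ?_⟩⟩
  · change A.1 _ (𝔓.Tact g p v) - 𝔓.Tact g p v = 𝔓.Tact g p (A.1 p v - v)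
    rw [apply_Tact, map_sub]
  · rintro _ ⟨v, rfl⟩
    exact hA p v
  · exact sub_eq_zero.2 (apply_of_Tproj_eq_zero A hv)

end AutTG

namespace EndN
variable [IsManifold IP ∞ P] {𝔓}

theorem Tproj_apply (B : 𝔓.EndN) (p : P) (v : TangentSpace IP p) : 𝔓.Tproj p (B.1 p v) = 0 :=
  (B.2.2.2 p).1 ⟨v, rfl⟩

theorem apply_of_Tproj_eq_zero (B : 𝔓.EndN) {p : P} {v : TangentSpace IP p}
    (hv : 𝔓.Tproj p v = 0) : B.1 p v = 0 :=
  (B.2.2.2 p).2 hv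

theorem apply_add_apply (B C : 𝔓.EndN) (p : P) (v : TangentSpace IP p) :
    B.1 p (v + C.1 p v) = B.1 p v := by
  rw [map_add, apply_of_Tproj_eq_zero B (Tproj_apply C p v), add_zero]

/-- The family `id + B` of linear isomorphisms, with inverse `id - B` since `B ∘ B = 0`. -/
noncomputable def idAdd (B : 𝔓.EndN) (p : P) : TangentSpace IP p ≃L[ℝ] TangentSpace IP p :=
  ContinuousLinearEquiv.equivOfInverse (ContinuousLinearMap.id ℝ _ + B.1 p)
    (ContinuousLinearMap.id ℝ _ + (-B).1 p)
    (fun v => (congrArg (v + B.1 p v + ·) (apply_add_apply (-B) B p v)).trans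
      (add_neg_cancel_right v (B.1 p v)))
    (fun v => (congrArg (v + (-B).1 p v + ·) (apply_add_apply B (-B) p v)).trans
      (neg_add_cancel_right v (B.1 p v)))

theorem idAdd_mem_AutTG [LieGroup IG ∞ G] [FiniteDimensional ℝ EP] (B : 𝔓.EndN) :
    idAdd B ∈ 𝔓.AutTG := by
  refine AutTG.mem_of_apply_Tact_of_apply_fund (IsSmoothTangentEndo.id.add B.2.1)
    (fun p g v => ?_) (fun p X => ?_)
  · change 𝔓.Tact g p v + B.1 _ _ = 𝔓.Tact g p (v + B.1 p v)
    rw [B.2.2.1, map_add]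
  · change 𝔓.fund p X + B.1 _ _ = _
    rw [apply_of_Tproj_eq_zero B (𝔓.Tproj_fund p X), add_zero]

end EndN

section EndNEquiv
variable [IsManifold IM ∞ M] [LieGroup IG ∞ G] [IsManifold IP ∞ P] [FiniteDimensional ℝ EP]

/-- The isomorphism `B ↦ id + B` of the additive group `End_N TP` onto `Aut_N TP`. -/
noncomputable def EndNEquiv : Multiplicative 𝔓.EndN ≃* 𝔓.AutN where
  toFun B := ⟨⟨EndN.idAdd B.toAdd, EndN.idAdd_mem_AutTG _⟩, fun p v => by
    change v + B.toAdd.1 p v - v ∈ _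
    rw [add_sub_cancel_left]
    exact EndN.Tproj_apply _ p v⟩
  invFun A := Multiplicative.ofAdd ⟨_, AutTG.sub_id_mem_EndN A.2⟩
  left_inv B := congrArg Multiplicative.ofAdd <| Subtype.ext <| funext fun p =>
    ContinuousLinearMap.ext fun v => add_sub_cancel_left v (B.toAdd.1 p v)
  right_inv A := Subtype.ext <| AutTG.ext fun p v => add_sub_cancel v (A.1.1 p v)
  map_mul' B C := Subtype.ext <| AutTG.ext fun p v => by
    change v + (B.toAdd.1 p v + C.toAdd.1 p v) =
      v + C.toAdd.1 p v + B.toAdd.1 p (v + C.toAdd.1 p v)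
    rw [EndN.apply_add_apply, add_assoc, add_comm (B.toAdd.1 p v)]

theorem EndNEquiv_apply (B : Multiplicative 𝔓.EndN) (p : P) (v : TangentSpace IP p) :
    (𝔓.EndNEquiv B).1.1 p v = v + B.toAdd.1 p v :=
  rfl

end EndNEquiv

theorem apply_eq_of_apply_Tproj_eq [IsManifold IM ∞ M] [LieGroup IG ∞ G] [IsManifold IP ∞ P]
    {C D : ∀ m : M, TangentSpace IM m →L[ℝ] TangentSpace IM m}
    (h : ∀ p v, C (𝔓.proj p) (𝔓.Tproj p v) = D (𝔓.proj p) (𝔓.Tproj p v)) (m : M)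
    (w : TangentSpace IM m) : C m w = D m w := by
  obtain ⟨p, rfl⟩ := 𝔓.proj_surjective m
  obtain ⟨v, rfl⟩ := 𝔓.Tproj_surjective p w
  exact h p v

namespace AutTG
variable [IsManifold IM ∞ M] [LieGroup IG ∞ G] [IsManifold IP ∞ P] [FiniteDimensional ℝ EP] {𝔓}

theorem Tproj_apply_congr (A : 𝔓.AutTG) {p q : P} (hpq : 𝔓.proj p = 𝔓.proj q)
    {v : TangentSpace IP p} {w : TangentSpace IP q}
    (hvw : (𝔓.Tproj p v : EM) = (𝔓.Tproj q w : EM)) :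
    (𝔓.Tproj p (A.1 p v) : EM) = 𝔓.Tproj q (A.1 q w) := by
  obtain ⟨g, rfl⟩ := 𝔓.exists_act_eq hpq
  have hvert : 𝔓.Tproj (𝔓.act p g) (w - 𝔓.Tact g p v) = 0 := by
    rw [map_sub, sub_eq_zero]
    exact hvw.symm.trans (𝔓.Tproj_Tact p g v).symm
  have hA := apply_of_Tproj_eq_zero A hvert
  rw [map_sub, apply_Tact, sub_eq_iff_eq_add] at hA
  rw [hA, map_add, hvert]
  exact (𝔓.Tproj_Tact p g (A.1 p v)).symm.trans (zero_add _).symm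

theorem exists_descent (A : 𝔓.AutTG) :
    ∃ C : ∀ m : M, TangentSpace IM m →L[ℝ] TangentSpace IM m,
      ∀ p v, C (𝔓.proj p) (𝔓.Tproj p v) = 𝔓.Tproj p (A.1 p v) := by
  choose point proj_point using 𝔓.proj_surjective
  choose τ hτ using 𝔓.exists_localTrivialization
  let lift (p : P) : EM →L[ℝ] EP := (τ (𝔓.proj p)).tangentLift p
  refine ⟨fun m => ((𝔓.Tproj (point m) : EP →L[ℝ] EM) ∘L
    (A.1 (point m) : EP ≃L[ℝ] EP).toContinuousLinearMap ∘L lift (point m) : EM →L[ℝ] EM),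
    fun p v => ?_⟩
  exact Tproj_apply_congr A (proj_point _)
    (LocalTrivialization.Tproj_tangentLift _ (hτ _) _)

/-- The family of endomorphisms of `TM` induced by an element of `Aut_{TG} TP`. -/
noncomputable def descent (A : 𝔓.AutTG) (m : M) : TangentSpace IM m →L[ℝ] TangentSpace IM m :=
  (exists_descent A).choose m

theorem descent_Tproj (A : 𝔓.AutTG) (p : P) (v : TangentSpace IP p) :
    descent A (𝔓.proj p) (𝔓.Tproj p v) = 𝔓.Tproj p (A.1 p v) :=
  (exists_descent A).choose_spec p v

theorem descent_one_apply (m : M) (w : TangentSpace IM m) : descent (1 : 𝔓.AutTG) m w = w :=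
  𝔓.apply_eq_of_apply_Tproj_eq (D := fun _ => ContinuousLinearMap.id ℝ _) (descent_Tproj 1) m w

theorem descent_mul_apply (A B : 𝔓.AutTG) (m : M) (w : TangentSpace IM m) :
    descent (A * B) m w = descent A m (descent B m w) := by
  refine 𝔓.apply_eq_of_apply_Tproj_eq (D := fun m => (descent A m).comp (descent B m))
    (fun p v => ?_) m w
  rw [ContinuousLinearMap.comp_apply, descent_Tproj, descent_Tproj, descent_Tproj]
  rfl

theorem isSmoothTangentEndo_descent (A : 𝔓.AutTG) : IsSmoothTangentEndo (descent A) := by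
  intro v
  obtain ⟨τ, hτ⟩ := 𝔓.exists_localTrivialization v.proj
  have hnear : ∀ᶠ w : TangentBundle IM M in nhds v, w.proj ∈ τ.baseSet :=
    (FiberBundle.continuous_proj EM (TangentSpace IM)).continuousAt.eventually
      (τ.isOpen_baseSet.mem_nhds hτ)
  have hsec : ContMDiffAt IM.tangent IP ∞ (fun w : TangentBundle IM M => τ.sec w.proj) v :=
    (τ.contMDiffAt_sec _ hτ).comp v (contMDiffAt_proj (TangentSpace IM))
  have hlift := τ.contMDiffAt_tangentLift (W := fun w : TangentBundle IM M => (w.snd : EM)) hsec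
    (by rwa [τ.proj_sec _ hτ]) (contMDiffAt_id.congr_of_eventuallyEq (hnear.mono fun w hw =>
      tangentBundle_mk_congr (τ.proj_sec _ hw) rfl))
  have hproj : ContMDiff IP.tangent IM.tangent ∞ (tangentMap IP IM 𝔓.proj) :=
    𝔓.contMDiff_proj.contMDiff_tangentMap (m := ∞) (by simp)
  refine ((hproj.comp A.2.1).contMDiffAt.comp v hlift).congr_of_eventuallyEq ?_
  filter_upwards [hnear] with w hw
  have hw_sec := τ.proj_sec _ hw
  refine tangentBundle_mk_congr hw_sec.symm ?_
  let p := τ.sec w.proj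
  have hTlift : 𝔓.Tproj p (τ.tangentLift p (w.snd : EM)) = (w.snd : EM) :=
    τ.Tproj_tangentLift (by rwa [hw_sec]) _
  have hdescent := descent_Tproj A p (τ.tangentLift p (w.snd : EM))
  exact (tangentSpace_clm_apply_congr hw_sec.symm (descent A) _).trans <|
    (congrArg (fun u : EM => (descent A (𝔓.proj p) : EM →L[ℝ] EM) u) hTlift.symm).trans hdescent

end AutTG

section AutProj
variable [IsManifold IM ∞ M] [LieGroup IG ∞ G] [IsManifold IP ∞ P]
  [FiniteDimensional ℝ EM] [FiniteDimensional ℝ EP] {𝔓}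

variable (𝔓) in
/-- The homomorphism `λ : Aut_{TG} TP → Aut₀ TM`. -/
noncomputable def autProj : 𝔓.AutTG →* TangentAut IM M :=
  MonoidHom.mk' (fun A => ⟨fun m =>
      ContinuousLinearEquiv.equivOfInverse (AutTG.descent A m) (AutTG.descent A⁻¹ m)
        (fun w => by rw [← AutTG.descent_mul_apply, inv_mul_cancel, AutTG.descent_one_apply])
        (fun w => by rw [← AutTG.descent_mul_apply, mul_inv_cancel, AutTG.descent_one_apply]),
      AutTG.isSmoothTangentEndo_descent A⟩)
    fun A B => TangentAut.ext (AutTG.descent_mul_apply A B)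

theorem autProj_Tproj (A : 𝔓.AutTG) (p : P) (v : TangentSpace IP p) :
    (𝔓.autProj A).1 (𝔓.proj p) (𝔓.Tproj p v) = 𝔓.Tproj p (A.1 p v) :=
  AutTG.descent_Tproj A p v

theorem autProj_eq_iff {A : 𝔓.AutTG} {C : TangentAut IM M} : 𝔓.autProj A = C ↔
    ∀ p v, C.1 (𝔓.proj p) (𝔓.Tproj p v) = 𝔓.Tproj p (A.1 p v) := by
  refine ⟨?_, fun h => TangentAut.ext <| 𝔓.apply_eq_of_apply_Tproj_eq
    (C := fun m => (𝔓.autProj A).1 m) (D := fun m => C.1 m) fun p v =>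
      (autProj_Tproj A p v).trans (h p v).symm⟩
  rintro rfl
  exact autProj_Tproj A

variable (𝔓) in
theorem ker_autProj : 𝔓.autProj.ker = 𝔓.AutN := by
  ext A
  rw [MonoidHom.mem_ker, autProj_eq_iff]
  refine forall₂_congr fun p v => ?_
  change 𝔓.Tproj p v = _ ↔ 𝔓.Tproj p (A.1 p v - v) = 0
  rw [map_sub, sub_eq_zero, eq_comm]

end AutProj

namespace Connection
variable [IsManifold IM ∞ M] [LieGroup IG ∞ G] [IsManifold IP ∞ P] {𝔓} (α : 𝔓.Connection)

theorem ext_form_Tproj {p : P} {v w : TangentSpace IP p} (hform : α.form p v = α.form p w)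
    (hproj : 𝔓.Tproj p v = 𝔓.Tproj p w) : v = w := by
  obtain ⟨X, hX⟩ := 𝔓.vert_le_range_fund p (v - w) (by rw [map_sub, hproj, sub_self])
  have hX₀ : X = 0 := by rw [← α.form_fund p X, hX, map_sub, hform, sub_self]
  rwa [hX₀, map_zero, eq_comm, sub_eq_zero] at hX

theorem form_lift (p : P) (w : TangentSpace IM (𝔓.proj p)) : α.form p (α.lift p w) = 0 :=
  ((LinearEquiv.ofBijective _ (α.bijective_Tproj_hor p)).symm w).2

theorem Tproj_lift (p : P) (w : TangentSpace IM (𝔓.proj p)) : 𝔓.Tproj p (α.lift p w) = w :=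
  (LinearEquiv.ofBijective _ (α.bijective_Tproj_hor p)).apply_symm_apply w

theorem lift_Tproj_apply (p : P) (v : TangentSpace IP p) :
    α.lift p (𝔓.Tproj p v) = v + 𝔓.fund p (-α.form p v) := by
  apply α.ext_form_Tproj
  · rw [form_lift, map_add, α.form_fund, add_neg_cancel]
  · rw [Tproj_lift, map_add, 𝔓.Tproj_fund, add_zero]

theorem contMDiffAt_lift {E₀ H₀ N : Type*} [NormedAddCommGroup E₀] [NormedSpace ℝ E₀]
    [TopologicalSpace H₀] {J : ModelWithCorners ℝ E₀ H₀} [TopologicalSpace N] [ChartedSpace H₀ N]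
    [IsManifold J 1 N] {b : N → P} {W : ∀ k, TangentSpace IM (𝔓.proj (b k))} {k₀ : N}
    (hb : ContMDiffAt J IP ∞ b k₀)
    (hW : ContMDiffAt J IM.tangent ∞ (fun k => (⟨𝔓.proj (b k), W k⟩ : TangentBundle IM M)) k₀) :
    ContMDiffAt J IP.tangent ∞
      (fun k => (⟨b k, α.lift (b k) (W k)⟩ : TangentBundle IP P)) k₀ := by
  obtain ⟨τ, hτ⟩ := 𝔓.exists_localTrivialization (𝔓.proj (b k₀))
  have hL := τ.contMDiffAt_tangentLift hb hτ hW
  have hform : ContMDiffAt (M' := EG) J 𝓘(ℝ, EG) ∞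
      (fun k => (-α.form (b k) (τ.tangentLift (b k) (W k)) : EG)) k₀ :=
    (α.smooth.contMDiffAt.comp k₀ hL).neg
  refine (contMDiffAt_totalSpace_mk_add hL
    (𝔓.contMDiffAt_fund hb hform)).congr_of_eventuallyEq ?_
  have hnear : ∀ᶠ k in nhds k₀, 𝔓.proj (b k) ∈ τ.baseSet :=
    (𝔓.contMDiff_proj.continuous.continuousAt.comp hb.continuousAt).eventually
      (τ.isOpen_baseSet.mem_nhds hτ)
  filter_upwards [hnear] with k hk
  have h := α.lift_Tproj_apply (b k) (τ.tangentLift (b k) (W k))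
  rw [τ.Tproj_tangentLift hk] at h
  exact congrArg _ h

section Horizontal
variable [FiniteDimensional ℝ EM] (C : TangentAut IM M)

/-- The linear map `Π^v_α(p) + Γ_α(p) ∘ C ∘ T_p μ`. -/
noncomputable def horizontalMap (p : P) : TangentSpace IP p →ₗ[ℝ] TangentSpace IP p :=
  (α.verticalProj p).toLinearMap + α.lift p ∘ₗ
    (C.1 (𝔓.proj p)).toLinearEquiv.toLinearMap ∘ₗ (𝔓.Tproj p).toLinearMap

theorem horizontalMap_apply (p : P) (v : TangentSpace IP p) :
    α.horizontalMap C p v =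
      𝔓.fund p (α.form p v) + α.lift p (C.1 (𝔓.proj p) (𝔓.Tproj p v)) :=
  rfl

theorem form_horizontalMap (p : P) (v : TangentSpace IP p) :
    α.form p (α.horizontalMap C p v) = α.form p v := by
  rw [horizontalMap_apply, map_add, form_lift, add_zero, α.form_fund]

theorem Tproj_horizontalMap (p : P) (v : TangentSpace IP p) :
    𝔓.Tproj p (α.horizontalMap C p v) = C.1 (𝔓.proj p) (𝔓.Tproj p v) := by
  rw [horizontalMap_apply, map_add, Tproj_lift, 𝔓.Tproj_fund, zero_add]

theorem horizontalMap_mul (D : TangentAut IM M) (p : P) (v : TangentSpace IP p) :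
    α.horizontalMap (C * D) p v = α.horizontalMap C p (α.horizontalMap D p v) := by
  apply α.ext_form_Tproj
  · simp only [form_horizontalMap]
  · simp only [Tproj_horizontalMap]
    rfl

theorem horizontalMap_apply_of_mul_eq_one {C D : TangentAut IM M} (h : C * D = 1) (p : P)
    (v : TangentSpace IP p) : α.horizontalMap C p (α.horizontalMap D p v) = v := by
  rw [← horizontalMap_mul, h]
  apply α.ext_form_Tproj
  · rw [form_horizontalMap]
  · rw [Tproj_horizontalMap]
    rfl

theorem horizontalMap_Tact (p : P) (g : G) (v : TangentSpace IP p) :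
    α.horizontalMap C (𝔓.act p g) (𝔓.Tact g p v) = 𝔓.Tact g p (α.horizontalMap C p v) := by
  apply α.ext_form_Tproj
  · simp only [form_horizontalMap, form_Tact]
  · have hright := 𝔓.Tproj_Tact p g (α.horizontalMap C p v)
    rw [Tproj_horizontalMap] at hright ⊢
    refine Eq.trans ?_ hright.symm
    exact (tangentSpace_clm_apply_congr (𝔓.proj_act p g) (fun m => (C.1 m).toContinuousLinearMap)
      _).trans (congrArg (fun w : EM => (C.1 (𝔓.proj p) : EM ≃L[ℝ] EM) w) (𝔓.Tproj_Tact p g v))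

theorem horizontalMap_fund (p : P) (X : TangentSpace IG (1 : G)) :
    α.horizontalMap C p (𝔓.fund p X) = 𝔓.fund p X := by
  rw [horizontalMap_apply, α.form_fund, 𝔓.Tproj_fund, map_zero, map_zero, add_zero]

theorem contMDiff_horizontalMap :
    ContMDiff IP.tangent IP.tangent ∞ (fun w : TangentBundle IP P =>
      (⟨w.proj, α.horizontalMap C w.proj w.snd⟩ : TangentBundle IP P)) := by
  intro v
  have hbase : ContMDiffAt IP.tangent IP ∞ (fun w : TangentBundle IP P => w.proj) v :=
    contMDiffAt_proj (TangentSpace IP)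
  have hproj : ContMDiff IP.tangent IM.tangent ∞ (tangentMap IP IM 𝔓.proj) :=
    𝔓.contMDiff_proj.contMDiff_tangentMap (m := ∞) (by simp)
  exact contMDiffAt_totalSpace_mk_add (𝔓.contMDiffAt_fund hbase α.smooth.contMDiffAt)
    (α.contMDiffAt_lift hbase ((C.2.comp hproj) v))

end Horizontal

section AutLift
variable [FiniteDimensional ℝ EM] [FiniteDimensional ℝ EP] (C : TangentAut IM M)

/-- The isomorphism `Π^v_α(p) + Γ_α(p) ∘ C ∘ T_p μ` of `T_p P`, with inverse given by `C⁻¹`. -/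
noncomputable def horizontalEquiv (p : P) : TangentSpace IP p ≃L[ℝ] TangentSpace IP p :=
  LinearEquiv.toContinuousLinearEquiv (E := EP) (F := EP) (𝕜 := ℝ)
    (LinearEquiv.ofLinearMap (α.horizontalMap C p) (α.horizontalMap C⁻¹ p)
      (LinearMap.ext (α.horizontalMap_apply_of_mul_eq_one (mul_inv_cancel C) p))
      (LinearMap.ext (α.horizontalMap_apply_of_mul_eq_one (inv_mul_cancel C) p)))

/-- The homomorphism `σ_α : Aut₀ TM → Aut_{TG} TP` of a connection `α`. -/
noncomputable def autLift : TangentAut IM M →* 𝔓.AutTG :=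
  MonoidHom.mk' (fun C => ⟨α.horizontalEquiv C, AutTG.mem_of_apply_Tact_of_apply_fund
      (α.contMDiff_horizontalMap C) (α.horizontalMap_Tact C) (α.horizontalMap_fund C)⟩)
    fun C D => AutTG.ext (α.horizontalMap_mul C D)

theorem autLift_apply (p : P) (v : TangentSpace IP p) : (α.autLift C).1 p v =
    α.verticalProj p v + α.lift p (C.1 (𝔓.proj p) (𝔓.Tproj p v)) :=
  rfl

theorem autProj_autLift : 𝔓.autProj (α.autLift C) = C :=
  autProj_eq_iff.2 fun p v => (α.Tproj_horizontalMap C p v).symm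

end AutLift

end Connection

section AutExtension
variable [FiniteDimensional ℝ EM] [IsManifold IM ∞ M] [T2Space M] [SecondCountableTopology M]
  [LieGroup IG ∞ G] [FiniteDimensional ℝ EP] [IsManifold IP ∞ P]

theorem autProj_surjective : Function.Surjective 𝔓.autProj :=
  𝔓.nonempty_connection.elim fun α C => ⟨α.autLift C, α.autProj_autLift C⟩

/-- The extension `End_N TP → Aut_{TG} TP → Aut₀ TM`, the kernel `Aut_N TP` of `λ` being identified
with the additive group `End_N TP` through `B ↦ id + B`. -/
noncomputable def autExtension :
    GroupExtension (Multiplicative 𝔓.EndN) 𝔓.AutTG (TangentAut IM M) where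
  inl := 𝔓.AutN.subtype.comp 𝔓.EndNEquiv.toMonoidHom
  rightHom := 𝔓.autProj
  inl_injective := Subtype.val_injective.comp 𝔓.EndNEquiv.injective
  range_inl_eq_ker_rightHom := by
    rw [ker_autProj, MonoidHom.range_comp, MonoidHom.range_eq_top.2 𝔓.EndNEquiv.surjective,
      ← MonoidHom.range_eq_map, Subgroup.range_subtype]
  rightHom_surjective := 𝔓.autProj_surjective

namespace Connection
variable {𝔓} (α : 𝔓.Connection)

/-- The splitting `σ_α` of the extension of `Aut₀ TM` by `End_N TP` that a connection defines. -/
noncomputable def splitting : 𝔓.autExtension.Splitting where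
  toMonoidHom := α.autLift
  rightInverse_rightHom := α.autProj_autLift

theorem conjAct_splitting_apply (C : TangentAut IM M) (B : Multiplicative 𝔓.EndN) (p : P)
    (v : TangentSpace IP p) : (α.splitting.conjAct C B).toAdd.1 p v =
      B.toAdd.1 p (α.lift p ((C⁻¹).1 (𝔓.proj p) (𝔓.Tproj p v))) := by
  have hconj : (𝔓.EndNEquiv (α.splitting.conjAct C B) : 𝔓.AutTG) =
      α.autLift C * 𝔓.EndNEquiv B * α.autLift C⁻¹ := by
    rw [map_inv]
    exact 𝔓.autExtension.inl_conjAct_comm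
  have happly : v + (α.splitting.conjAct C B).toAdd.1 p v = α.horizontalMap C p
      (α.horizontalMap C⁻¹ p v + B.toAdd.1 p (α.horizontalMap C⁻¹ p v)) :=
    congrArg (fun A : 𝔓.AutTG => A.1 p v) hconj
  obtain ⟨X, hX⟩ :=
    𝔓.vert_le_range_fund p _ (EndN.Tproj_apply B.toAdd p (α.horizontalMap C⁻¹ p v))
  rw [map_add, horizontalMap_apply_of_mul_eq_one α (mul_inv_cancel C), ← hX, horizontalMap_fund,
    hX, add_right_inj] at happly
  rw [happly, horizontalMap_apply, map_add,
    EndN.apply_of_Tproj_eq_zero B.toAdd (𝔓.Tproj_fund p _), zero_add]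

end Connection

end AutExtension

end PrincipalBundle

theorem proposition2_general
    {EM HM EG HG EP HP : Type*}
    [NormedAddCommGroup EM] [NormedSpace ℝ EM] [FiniteDimensional ℝ EM] [TopologicalSpace HM]
    [NormedAddCommGroup EG] [NormedSpace ℝ EG] [TopologicalSpace HG]
    [NormedAddCommGroup EP] [NormedSpace ℝ EP] [FiniteDimensional ℝ EP] [TopologicalSpace HP]
    {IM : ModelWithCorners ℝ EM HM} {IG : ModelWithCorners ℝ EG HG}
    {IP : ModelWithCorners ℝ EP HP}
    {M G P : Type*}
    [TopologicalSpace M] [ChartedSpace HM M] [IsManifold IM ∞ M]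
    [T2Space M] [SecondCountableTopology M]
    [TopologicalSpace G] [ChartedSpace HG G] [Group G] [LieGroup IG ∞ G]
    [TopologicalSpace P] [ChartedSpace HP P] [IsManifold IP ∞ P]
    (𝔓 : PrincipalBundle IM IG IP M G P) :
    ∃ ν : Multiplicative 𝔓.EndN ≃* 𝔓.AutN,
      (∀ (B : 𝔓.EndN) (p : P) (v : TangentSpace IP p),
        (ν (Multiplicative.ofAdd B)).1.1 p v = v + B.1 p v) ∧
      ∃ lam : 𝔓.AutTG →* TangentAut IM M,
        (∀ (A : 𝔓.AutTG) (p : P) (v : TangentSpace IP p),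
          (lam A).1 (𝔓.proj p) (𝔓.Tproj p v) = 𝔓.Tproj p (A.1 p v)) ∧
        (∀ l : 𝔓.AutTG → TangentAut IM M,
          (∀ (A : 𝔓.AutTG) (p : P) (v : TangentSpace IP p),
            (l A).1 (𝔓.proj p) (𝔓.Tproj p v) = 𝔓.Tproj p (A.1 p v)) → l = lam) ∧
        Function.Injective 𝔓.AutN.subtype ∧
        𝔓.AutN.subtype.range = lam.ker ∧
        Function.Surjective lam ∧
        ∀ α : 𝔓.Connection,
          ∃ (σ : TangentAut IM M →* 𝔓.AutTG) (β : 𝔓.AutTG → 𝔓.AutN),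
            (∀ (C : TangentAut IM M) (p : P) (v : TangentSpace IP p),
              (σ C).1 p v = α.verticalProj p v + α.lift p (C.1 (𝔓.proj p) (𝔓.Tproj p v))) ∧
            (∀ A : 𝔓.AutTG, (β A : 𝔓.AutTG) = A * (σ (lam A))⁻¹) ∧
            Function.Injective σ ∧
            Function.Surjective β ∧
            (∀ A : 𝔓.AutTG, β A = 1 ↔ A ∈ σ.range) ∧
            (∀ C : TangentAut IM M, lam (σ C) = C) ∧
            (∀ N : 𝔓.AutN, β (N : 𝔓.AutTG) = N) ∧
            (∀ A₁ A₂ : 𝔓.AutTG, (β (A₁ * A₂) : 𝔓.AutTG) =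
              β A₁ * σ (lam A₁) * β A₂ * (σ (lam A₁))⁻¹) ∧
            ∃ (φ : TangentAut IM M →* MulAut (Multiplicative 𝔓.EndN))
              (Ψ : (Multiplicative 𝔓.EndN ⋊[φ] TangentAut IM M) ≃* 𝔓.AutTG),
              (∀ x y : Multiplicative 𝔓.EndN ⋊[φ] TangentAut IM M,
                (x * y).right = x.right * y.right ∧
                ∀ (p : P) (v : TangentSpace IP p),
                  (Multiplicative.toAdd (x * y).left).1 p v =
                    (Multiplicative.toAdd x.left).1 p v +
                    (Multiplicative.toAdd y.left).1 p
                      (α.lift p ((x.right⁻¹).1 (𝔓.proj p) (𝔓.Tproj p v)))) ∧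
              (∀ x : Multiplicative 𝔓.EndN ⋊[φ] TangentAut IM M,
                Ψ x = (ν x.left : 𝔓.AutTG) * σ x.right) := by
  refine ⟨𝔓.EndNEquiv, fun B => 𝔓.EndNEquiv_apply _, 𝔓.autProj, PrincipalBundle.autProj_Tproj,
    fun l hl => funext fun A => (PrincipalBundle.autProj_eq_iff.2 (hl A)).symm,
    𝔓.AutN.subtype_injective, 𝔓.AutN.range_subtype.trans 𝔓.ker_autProj.symm,
    𝔓.autProj_surjective, fun α => ?_⟩
  let s := α.splitting
  have hβ (N : 𝔓.AutN) : 𝔓.EndNEquiv (kernelPart s N) = N := by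
    obtain ⟨B, rfl⟩ := 𝔓.EndNEquiv.surjective N
    exact congrArg 𝔓.EndNEquiv (kernelPart_inl s B)
  refine ⟨α.autLift, fun A => 𝔓.EndNEquiv (kernelPart s A), α.autLift_apply, inl_kernelPart s,
    Function.LeftInverse.injective α.autProj_autLift, fun N => ⟨N, hβ N⟩, fun A => ?_,
    α.autProj_autLift, hβ, inl_kernelPart_mul s, s.conjAct, s.semidirectProductMulEquiv,
    fun x y => ⟨rfl, fun p v => ?_⟩, fun _ => rfl⟩
  · exact (map_eq_one_iff _ 𝔓.EndNEquiv.injective).trans (kernelPart_eq_one_iff s)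
  · exact congrArg (x.left.toAdd.1 p v + ·) (α.conjAct_splitting_apply x.right y.left p v)

theorem proposition2
    {EM HM EG HG EP HP : Type*}
    [NormedAddCommGroup EM] [NormedSpace ℝ EM] [FiniteDimensional ℝ EM] [TopologicalSpace HM]
    [NormedAddCommGroup EG] [NormedSpace ℝ EG] [FiniteDimensional ℝ EG] [TopologicalSpace HG]
    [NormedAddCommGroup EP] [NormedSpace ℝ EP] [FiniteDimensional ℝ EP] [TopologicalSpace HP]
    {IM : ModelWithCorners ℝ EM HM} [IM.Boundaryless]
    {IG : ModelWithCorners ℝ EG HG} [IG.Boundaryless]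
    {IP : ModelWithCorners ℝ EP HP} [IP.Boundaryless]
    {M G P : Type*}
    [TopologicalSpace M] [ChartedSpace HM M] [IsManifold IM ∞ M]
    [T2Space M] [SecondCountableTopology M]
    [TopologicalSpace G] [ChartedSpace HG G] [Group G] [LieGroup IG ∞ G]
    [TopologicalSpace P] [ChartedSpace HP P] [IsManifold IP ∞ P]
    (𝔓 : PrincipalBundle IM IG IP M G P) :
    -- the group `Aut_N TP` is the additive group `End_N TP` through `B ↦ id + B`
    ∃ ν : Multiplicative 𝔓.EndN ≃* 𝔓.AutN,
      (∀ (B : 𝔓.EndN) (p : P) (v : TangentSpace IP p),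
        (ν (Multiplicative.ofAdd B)).1.1 p v = v + B.1 p v) ∧
      -- (i) `λ` and the short exact sequence
      ∃ lam : 𝔓.AutTG →* TangentAut IM M,
        (∀ (A : 𝔓.AutTG) (p : P) (v : TangentSpace IP p),
          (lam A).1 (𝔓.proj p) (𝔓.Tproj p v) = 𝔓.Tproj p (A.1 p v)) ∧
        (∀ l : 𝔓.AutTG → TangentAut IM M,
          (∀ (A : 𝔓.AutTG) (p : P) (v : TangentSpace IP p),
            (l A).1 (𝔓.proj p) (𝔓.Tproj p v) = 𝔓.Tproj p (A.1 p v)) → l = lam) ∧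
        Function.Injective 𝔓.AutN.subtype ∧
        𝔓.AutN.subtype.range = lam.ker ∧
        Function.Surjective lam ∧
        -- (ii) the maps `σ_α` and `β_α` of a connection `α`
        ∀ α : 𝔓.Connection,
          ∃ (σ : TangentAut IM M →* 𝔓.AutTG) (β : 𝔓.AutTG → 𝔓.AutN),
            (∀ (C : TangentAut IM M) (p : P) (v : TangentSpace IP p),
              (σ C).1 p v = α.verticalProj p v + α.lift p (C.1 (𝔓.proj p) (𝔓.Tproj p v))) ∧
            (∀ A : 𝔓.AutTG, (β A : 𝔓.AutTG) = A * (σ (lam A))⁻¹) ∧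
            Function.Injective σ ∧
            Function.Surjective β ∧
            (∀ A : 𝔓.AutTG, β A = 1 ↔ A ∈ σ.range) ∧
            (∀ C : TangentAut IM M, lam (σ C) = C) ∧
            (∀ N : 𝔓.AutN, β (N : 𝔓.AutTG) = N) ∧
            (∀ A₁ A₂ : 𝔓.AutTG, (β (A₁ * A₂) : 𝔓.AutTG) =
              β A₁ * σ (lam A₁) * β A₂ * (σ (lam A₁))⁻¹) ∧
            -- (iii) the semidirect product, its product formula, and the decomposition
            ∃ (φ : TangentAut IM M →* MulAut (Multiplicative 𝔓.EndN))
              (Ψ : (Multiplicative 𝔓.EndN ⋊[φ] TangentAut IM M) ≃* 𝔓.AutTG),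
              (∀ x y : Multiplicative 𝔓.EndN ⋊[φ] TangentAut IM M,
                (x * y).right = x.right * y.right ∧
                ∀ (p : P) (v : TangentSpace IP p),
                  (Multiplicative.toAdd (x * y).left).1 p v =
                    (Multiplicative.toAdd x.left).1 p v +
                    (Multiplicative.toAdd y.left).1 p
                      (α.lift p ((x.right⁻¹).1 (𝔓.proj p) (𝔓.Tproj p v)))) ∧
              (∀ x : Multiplicative 𝔓.EndN ⋊[φ] TangentAut IM M,
                Ψ x = (ν x.left : 𝔓.AutTG) * σ x.right) :=
  proposition2_general 𝔓
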